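/- **Existence of minimizers of the fluid functional in MOND.** Let $\lambda:[0,\infty)\to[0,\infty)$ be measurable such that * ($\Lambda$1) there is $\Lambda_1>0$ with $\lambda(\sigma)\ge\Lambda_1/\sqrt\sigma$ for all sufficiently small $\sigma>0$; * ($\Lambda$2) there is $\Lambda_2>0$ with $\lambda(\sigma)\le\Lambda_2/\sqrt\sigma$ for all $\sigma>0$. Let $0<n<3$ and let $\Psi\in C^1([0,\infty))$ be strictly convex with $\Psi(0)=\Psi'(0)=0$ and, for some $C>0$, $\Psi(s)\ge C s^{1+1/n}$ for all sufficiently large $s$. Let $M>0$ and fix a reference density $\bar\rho\in C_c(\mathbb R^3)$, $\bar\rho\ge0$, spherically symmetric, with $\|\bar\rho\|_1=M$. Here $\rho$ is called spherically symmetric if for every $A\in SO(3)$, $\rho(Ax)=\rho(x)$ for a.e. $x\in\mathbb R^3$. For $\rho\in L^1(\mathbb R^3)$ let $U^N_\rho(x)=-\int_{\mathbb R^3}\frac{\rho(y)}{|x-y|}\,dy$, with weak gradient $\nabla U^N_\rho$. Put $Q(v)=\int_0^v\lambda(w)\,w\,dw$ for $v\ge0$ and $$E_{pot}^N(\rho)=-\frac1{8\pi}\int|\nabla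 U^N_\rho|^2\,dx,\qquad E_{pot}^Q(\rho)=-\frac1{4\pi}\int\Bigl(Q(|\nabla U^N_\rho|)-Q(|\nabla U^N_{\bar\rho}|)\Bigr)dx,$$ $$E_{pot}^M=E_{pot}^N+E_{pot}^Q,\qquad \mathcal C(\rho)=\int\Psi(\rho)\,dx,\qquad \mathcal H_E=E_{pot}^M+\mathcal C,$$ $$\mathcal R_M=\bigl\{\rho\in L^1(\mathbb R^3)\text{ spherically symmetric}:\ \rho\ge0,\ \|\rho\|_1=M,\ |E_{pot}^Q(\rho)|+\mathcal C(\rho)<\infty\bigr\}.$$ Let $(\rho_j)\subset\mathcal R_M$ be a minimizing sequence of $\mathcal H_E$, i.e. $\mathcal H_E(\rho_j)\to\inf_{\mathcal R_M}\mathcal H_E$. Then there exist a subsequence, again denoted by $(\rho_j)$, and a function $\rho_0$ such that 1. $\rho_j\rightharpoonup\rho_0$ weakly in $L^{1+1/n}(\mathbb R^3)$; 2. $\rho_0\in\mathcal R_M$ and $\rho_0$ is a minimizer of $\mathcal H_E$ over $\mathcal R_M$; 3. $\nabla U^N_{\rho_j}\to\nabla U^N_{\rho_0}$ strongly in $L^2(\mathbb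 R^3)$; 4. if, additionally, $\rho_0$ has compact support, then $\nabla U^N_{\rho_j}-\nabla U^N_{\rho_0}\to0$ strongly in $L^{3/2}(\mathbb R^3)$ (in particular, these differences belong to $L^{3/2}(\mathbb R^3)$). -/

import Mathlib

open MeasureTheory Filter Topology Set
open scoped ENNReal ContDiff

noncomputable section

/-- Three-dimensional Euclidean space. -/
abbrev E3 : Type := EuclideanSpace ℝ (Fin 3)

/-! ### Function spaces, convergence, symmetry -/

/-- `F` is the weak gradient of `u` on `ℝ³` (both locally integrable). -/
structure IsWeakGradient (u : E3 → ℝ) (F : E3 → E3) : Prop where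
  locallyIntegrable : LocallyIntegrable u volume
  locallyIntegrable_grad : LocallyIntegrable F volume
  integral_eq : ∀ φ : E3 → ℝ, ContDiff ℝ ∞ φ → HasCompactSupport φ → ∀ v : E3,
    ∫ x, u x * fderiv ℝ φ x v = - ∫ x, inner ℝ (F x) v * φ x

open Classical in
/-- The weak gradient of `u`, which is unique up to null sets (and `0` if there is none). -/
def weakGradient (u : E3 → ℝ) : E3 → E3 :=
  if h : ∃ F, IsWeakGradient u F then h.choose else 0

/-- Strong convergence `F j → F₀` in `L^p(ℝ³)`, including membership of all functions. -/
def ConvergesStronglyLp {V : Type*} [NormedAddCommGroup V] (p : ℝ≥0∞)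
    (F : ℕ → E3 → V) (F₀ : E3 → V) : Prop :=
  (∀ j, MemLp (F j) p volume) ∧ MemLp F₀ p volume ∧
    Tendsto (fun j => eLpNorm (fun x => F j x - F₀ x) p volume) atTop (𝓝 0)

/-- Weak convergence `f j ⇀ f₀` in `L^p(ℝ³)` for `1 < p < ∞`: all functions lie in `L^p`, and
`∫ f j g → ∫ f₀ g` for every `g` in `L^q`, where `1 / p + 1 / q = 1`. -/
def ConvergesWeaklyLp (p : ℝ≥0∞) (f : ℕ → E3 → ℝ) (f₀ : E3 → ℝ) : Prop :=
  (∀ j, MemLp (f j) p volume) ∧ MemLp f₀ p volume ∧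
    ∀ q : ℝ≥0∞, p⁻¹ + q⁻¹ = 1 → ∀ g : E3 → ℝ, MemLp g q volume →
      Tendsto (fun j => ∫ x, f j x * g x) atTop (𝓝 (∫ x, f₀ x * g x))

/-- `f(Ax) = f(x)` for a.e. `x`, for every rotation `A ∈ SO(3)`. -/
def SphericallySymmetric (f : E3 → ℝ) : Prop :=
  ∀ A : E3 ≃ₗᵢ[ℝ] E3, LinearMap.det (A.toLinearEquiv : E3 →ₗ[ℝ] E3) = 1 →
    ∀ᵐ x, f (A x) = f x

/-- `f` vanishes a.e. outside a compact set. -/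
def CompactlySupportedAE (f : E3 → ℝ) : Prop :=
  ∃ K : Set E3, IsCompact K ∧ ∀ᵐ x, x ∉ K → f x = 0

/-- `(ρ j)` is a minimizing sequence of `H` over `R`. The infimum is taken in `[-∞, ∞]`. -/
def IsMinimizingSequence (H : (E3 → ℝ) → ℝ) (R : Set (E3 → ℝ)) (ρ : ℕ → E3 → ℝ) : Prop :=
  (∀ j, ρ j ∈ R) ∧
    Tendsto (fun j => (H (ρ j) : EReal)) atTop (𝓝 (⨅ σ ∈ R, (H σ : EReal)))

/-! ### Potentials and energies -/

/-- The Newtonian potential `U^N_ρ(x) = - ∫ ρ(y) / |x - y| dy`. -/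
def newtonPotential (ρ : E3 → ℝ) (x : E3) : ℝ :=
  - ∫ y, ρ y / ‖x - y‖

/-- `∇ U^N_ρ`. -/
def gradNewton (ρ : E3 → ℝ) : E3 → E3 :=
  weakGradient (newtonPotential ρ)

/-- `Q(v) = ∫₀^v lam(w) w dw`. -/
def mondQ (lam : ℝ → ℝ) (v : ℝ) : ℝ :=
  ∫ w in (0 : ℝ)..v, lam w * w

/-- The Newtonian part of the potential energy. -/
def EpotN (ρ : E3 → ℝ) : ℝ :=
  - (1 / (8 * Real.pi)) * ∫ x, ‖gradNewton ρ x‖ ^ 2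

/-- The integrand `Q(|∇U^N_ρ|) - Q(|∇U^N_ρbar|)` of the Mondian part of the potential energy. -/
def mondIntegrand (lam : ℝ → ℝ) (ρbar ρ : E3 → ℝ) (x : E3) : ℝ :=
  mondQ lam ‖gradNewton ρ x‖ - mondQ lam ‖gradNewton ρbar x‖

/-- The Mondian part of the potential energy, with respect to the reference density `ρbar`. -/
def EpotQ (lam : ℝ → ℝ) (ρbar ρ : E3 → ℝ) : ℝ :=
  - (1 / (4 * Real.pi)) * ∫ x, mondIntegrand lam ρbar ρ x

/-- The Mondian potential energy, with respect to the reference density `ρbar`. -/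
def EpotM (lam : ℝ → ℝ) (ρbar ρ : E3 → ℝ) : ℝ :=
  EpotN ρ + EpotQ lam ρbar ρ

/-- `C(ρ) = ∫ Ψ(ρ) dx`. -/
def casimir (Ψ : ℝ → ℝ) (ρ : E3 → ℝ) : ℝ :=
  ∫ x, Ψ (ρ x)

/-- The functional `H_E = E_pot^M + C`. -/
def energyHE (lam Ψ : ℝ → ℝ) (ρbar ρ : E3 → ℝ) : ℝ :=
  EpotM lam ρbar ρ + casimir Ψ ρ

/-- The set `R_M` of admissible densities: nonnegative, spherically symmetric, integrable, of mass
`M`, and such that the integrals defining `E_pot^Q(ρ)` and `C(ρ)` are finite. -/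
structure IsAdmissible (lam Ψ : ℝ → ℝ) (ρbar : E3 → ℝ) (M : ℝ) (ρ : E3 → ℝ) : Prop where
  integrable : Integrable ρ volume
  symmetric : SphericallySymmetric ρ
  nonneg : ∀ᵐ x, 0 ≤ ρ x
  mass : ∫ x, |ρ x| = M
  finite_EpotQ : Integrable (mondIntegrand lam ρbar ρ) volume
  finite_casimir : Integrable (fun x => Ψ (ρ x)) volume

/-- The set `R_M`. -/
def admissibleSet (lam Ψ : ℝ → ℝ) (ρbar : E3 → ℝ) (M : ℝ) : Set (E3 → ℝ) :=
  {ρ | IsAdmissible lam Ψ ρbar M ρ}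

/-! ### Assumptions on the data (only values on `[0, ∞)` matter) -/

/-- `lam : [0, ∞) → [0, ∞)` is measurable, `lam(σ) ≥ Λ₁ / √σ` for small `σ > 0`, and
`lam(σ) ≤ Λ₂ / √σ` for all `σ > 0`. -/
structure LambdaAssumptions (lam : ℝ → ℝ) : Prop where
  measurable : Measurable ((Ici (0 : ℝ)).domRestrict lam)
  nonneg : ∀ σ, 0 ≤ σ → 0 ≤ lam σ
  lower : ∃ Λ₁ : ℝ, 0 < Λ₁ ∧ ∀ᶠ σ in 𝓝[>] (0 : ℝ), Λ₁ / √σ ≤ lam σ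
  upper : ∃ Λ₂ : ℝ, 0 < Λ₂ ∧ ∀ σ, 0 < σ → lam σ ≤ Λ₂ / √σ

/-- `Ψ ∈ C¹([0, ∞))`, `Ψ(0) = Ψ'(0) = 0`, `Ψ` is strictly convex, and `Ψ(s) ≥ C s^(1 + 1 / n)` for
large `s`. -/
structure PsiAssumptions (n : ℝ) (Ψ : ℝ → ℝ) : Prop where
  contDiffOn : ContDiffOn ℝ 1 Ψ (Ici 0)
  zero : Ψ 0 = 0
  deriv_zero : derivWithin Ψ (Ici 0) 0 = 0
  strictConvexOn : StrictConvexOn ℝ (Ici 0) Ψ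
  lower : ∃ C : ℝ, 0 < C ∧ ∀ᶠ s in atTop, C * s ^ (1 + 1 / n) ≤ Ψ s

/-- The reference density: continuous, compactly supported, nonnegative, spherically symmetric, of
mass `M`. -/
structure IsReferenceDensity (M : ℝ) (ρbar : E3 → ℝ) : Prop where
  continuous : Continuous ρbar
  hasCompactSupport : HasCompactSupport ρbar
  nonneg : ∀ x, 0 ≤ ρbar x
  symmetric : SphericallySymmetric ρbar
  mass : ∫ x, |ρbar x| = M

end

/-! By Newton's shell theorem, a radial density with mass `m r` in the ball of radius `r` has field
strength `m r / r ^ 2`. Every statement about `∇U` thus becomes one about the monotone function `m`.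
Weak convergence tested on indicators of balls gives pointwise convergence of `m`, hence of the
fields at every point. Since `m r` is at most `M` and at most a constant times `r ^ (3 / (n + 1))`
(Hölder), the fields have a common `L²` majorant, and dominated convergence yields strong `L²`
convergence (`IsWeakLimit.exists_fieldBound`).

Coercivity (`exists_casimir_le_energyHE`): interpolating the two bounds on `m` controls the field
energy by a power less than one of `∫ ρ ^ (1 + 1 / n)`; this is where `n < 3` is essential. Outside
the support of `ρbar` the field of `ρbar` is the largest possible, so the outer part of the Mondian
energy is nonnegative, while on a ball `Q v ≤ Λ (1 + v ^ 2)`. Hence a minimizing sequence has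
bounded Casimir functional and is bounded in `L^(1+1/n)`.

No mass escapes (`mass_eq_of_integrableOn_outer`): for small arguments `Q` grows at least like the
power `3/2`, so a mass deficit `δ` would make the outer integrand at least a constant times `(δ / r
^ 2) ^ (3/2)`, a multiple of `r ^ (-3)`, which is not integrable at infinity. Fatou's lemma shows
that the outer integral of the limit is finite, so the deficit vanishes.

The Newtonian energy converges, while the Mondian energy and the Casimir functional are lower
semicontinuous along the sequence, so the limit is a minimizer. Minimality turns these inequalities
into equalities. In particular the Mondian energies converge, and for compactly supported `ρ₀` the
outer integrals, which dominate the `L^(3/2)` norm of the field differences, tend to zero. -/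

/-! ### Rotations and radial representatives -/

theorem finrank_E3 : Module.finrank ℝ E3 = 3 := by simp

/-- The rotation group acts transitively on spheres. -/
theorem exists_rotation_map_eq {x y : E3} (h : ‖x‖ = ‖y‖) :
    ∃ A : E3 ≃ₗᵢ[ℝ] E3, LinearMap.det (A.toLinearEquiv : E3 →ₗ[ℝ] E3) = 1 ∧ A x = y := by
  rcases eq_or_ne x y with rfl | hne
  · exact ⟨LinearIsometryEquiv.refl ℝ E3, by simp, rfl⟩
  obtain ⟨w, hw0, hwy⟩ : ∃ w : E3, w ≠ 0 ∧ inner ℝ w y = 0 := by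
    have hr : Module.finrank ℝ ((ℝ ∙ y)ᗮ : Submodule ℝ E3) ≠ 0 := by
      have h1 := Submodule.finrank_add_finrank_orthogonal (ℝ ∙ y)
      have h2 : Module.finrank ℝ (ℝ ∙ y) ≤ 1 := by
        simpa using finrank_span_le_card (R := ℝ) ({y} : Set E3)
      rw [finrank_E3] at h1
      omega
    have : (ℝ ∙ y)ᗮ ≠ ⊥ := fun h0 => hr (by rw [h0]; simp)
    obtain ⟨w, hw, hw0⟩ := Submodule.exists_mem_ne_zero_of_ne_bot this
    exact ⟨w, hw0, Submodule.mem_orthogonal_singleton_iff_inner_left.1 hw⟩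
  have hdet : ∀ z : E3, z ≠ 0 →
      LinearMap.det (((ℝ ∙ z)ᗮ.reflection).toLinearEquiv : E3 →ₗ[ℝ] E3) = -1 := by
    intro z hz
    have := Submodule.det_reflection (𝕜 := ℝ) ((ℝ ∙ z)ᗮ)
    rw [Submodule.orthogonal_orthogonal, finrank_span_singleton hz] at this
    simpa using this
  -- The first reflection exchanges `x` and `y` but has determinant `-1`; the second fixes `y`,
  -- being along `w ⟂ y`, and restores the determinant to `1`.
  refine ⟨((ℝ ∙ (x - y))ᗮ.reflection).trans ((ℝ ∙ w)ᗮ.reflection), ?_, ?_⟩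
  · have : (((((ℝ ∙ (x - y))ᗮ.reflection).trans ((ℝ ∙ w)ᗮ.reflection)).toLinearEquiv :
        E3 ≃ₗ[ℝ] E3) : E3 →ₗ[ℝ] E3) =
        (((ℝ ∙ w)ᗮ.reflection).toLinearEquiv : E3 →ₗ[ℝ] E3) ∘ₗ
        (((ℝ ∙ (x - y))ᗮ.reflection).toLinearEquiv : E3 →ₗ[ℝ] E3) := by
      ext; rfl
    rw [this, LinearMap.det_comp, hdet _ hw0, hdet _ (sub_ne_zero.2 hne)]
    norm_num
  · rw [LinearIsometryEquiv.trans_apply, Submodule.reflection_sub h]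
    apply Submodule.reflection_mem_subspace_eq_self
    exact Submodule.mem_orthogonal_singleton_iff_inner_right.2 hwy

/-- As `∫ 1_B(y - x) f(y) dy`, with a measurable representative of `f`, this is a parameter integral
of a jointly measurable kernel. -/
theorem measurable_setIntegral_closedBall {f : E3 → ℝ} (hf : AEStronglyMeasurable f volume)
    (r : ℝ) : Measurable fun x => ∫ y in Metric.closedBall x r, f y := by
  have h1 : ∀ x, ∫ y in Metric.closedBall x r, f y =
      ∫ y, (Metric.closedBall (0 : E3) r).indicator 1 (y - x) * hf.mk f y := by
    intro x
    rw [setIntegral_congr_ae (g := hf.mk f) Metric.isClosed_closedBall.measurableSet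
      (hf.ae_eq_mk.mono fun y hy _ => hy),
      ← integral_indicator Metric.isClosed_closedBall.measurableSet]
    congr 1
    ext y
    simp [indicator, dist_eq_norm]
  simp_rw [h1]
  have h2 : StronglyMeasurable (Function.uncurry fun (x y : E3) =>
      (Metric.closedBall (0 : E3) r).indicator (1 : E3 → ℝ) (y - x) * hf.mk f y) := by
    refine StronglyMeasurable.mul ?_ (hf.stronglyMeasurable_mk.comp_measurable measurable_snd)
    have : Measurable ((Metric.closedBall (0 : E3) r).indicator (1 : E3 → ℝ)) :=
      measurable_const.indicator Metric.isClosed_closedBall.measurableSet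
    exact (this.comp (measurable_snd.sub measurable_fst)).stronglyMeasurable
  exact h2.integral_prod_right.measurable

theorem SphericallySymmetric.setIntegral_closedBall {f : E3 → ℝ} (hf : SphericallySymmetric f)
    {x y : E3} (h : ‖x‖ = ‖y‖) (r : ℝ) :
    ∫ z in Metric.closedBall x r, f z = ∫ z in Metric.closedBall y r, f z := by
  obtain ⟨A, hA, rfl⟩ := exists_rotation_map_eq h
  have h1 := A.measurePreserving.setIntegral_preimage_emb
    A.toHomeomorph.measurableEmbedding f (Metric.closedBall (A x) r)
  rw [← h1]
  have h2 : A ⁻¹' Metric.closedBall (A x) r = Metric.closedBall x r := by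
    ext z; simp
  rw [h2]
  exact (setIntegral_congr_ae Metric.isClosed_closedBall.measurableSet
    ((hf A hA).mono fun z hz _ => hz)).symm

/-- A spherically symmetric function is a.e. equal to a function of the norm. -/
theorem SphericallySymmetric.exists_radial {f : E3 → ℝ} (hf : SphericallySymmetric f)
    (hi : LocallyIntegrable f volume) :
    ∃ g : ℝ → ℝ, Measurable g ∧ f =ᵐ[volume] fun x => g ‖x‖ := by
  let e : E3 := EuclideanSpace.single 0 1
  have he : ‖e‖ = 1 := by simp [e]
  -- Symmetry holds only a.e., with an exceptional set depending on the rotation. Ball averages are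
  -- invariant at every point, and Lebesgue differentiation recovers `f` from them; the `limsup`
  -- below gives a limit that is defined and measurable everywhere.
  let F : ℕ → E3 → ℝ := fun k x => ⨍ y in Metric.closedBall x (1 / ((k : ℝ) + 1)), f y
  have hFsym : ∀ k x y, ‖x‖ = ‖y‖ → F k x = F k y := by
    intro k x y h
    simp only [F, setAverage_eq, hf.setIntegral_closedBall h]
    congr 2
    simp [measureReal_def, Measure.addHaar_closedBall_center]
  have hFm : ∀ k, Measurable (F k) := by
    intro k
    have : F k = fun x => (volume.real (Metric.closedBall (0 : E3) (1 / ((k : ℝ) + 1))))⁻¹ •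
        ∫ y in Metric.closedBall x (1 / ((k : ℝ) + 1)), f y := by
      ext x
      simp only [F, setAverage_eq]
      congr 2
      simp [measureReal_def, Measure.addHaar_closedBall_center]
    rw [this]
    exact Measurable.const_smul (measurable_setIntegral_closedBall hi.aestronglyMeasurable _)
      (_ : ℝ)
  let G : E3 → ℝ := fun x => limsup (fun k => F k x) atTop
  have hG : Measurable G := Measurable.limsup hFm
  refine ⟨fun r => G (r • e), hG.comp (by fun_prop), ?_⟩
  filter_upwards [IsUnifLocDoublingMeasure.ae_tendsto_average (μ := volume) hi 1] with x hx
  have h1 : Tendsto (fun k => F k x) atTop (𝓝 (f x)) := by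
    refine hx (l := atTop) (fun _ : ℕ => x) (fun k : ℕ => 1 / ((k : ℝ) + 1)) ?_ ?_
    · exact tendsto_nhdsWithin_iff.2 ⟨tendsto_one_div_add_atTop_nhds_zero_nat,
        Eventually.of_forall fun k => by simp only [mem_Ioi]; positivity⟩
    · refine Eventually.of_forall fun k => ?_
      simp only [one_mul]
      exact Metric.mem_closedBall_self (by positivity)
  have h2 : G (‖x‖ • e) = G x := by
    simp only [G]
    congr 1
    ext k
    exact hFsym k _ _ (by simp [norm_smul, he])
  change f x = G (‖x‖ • e)
  rw [h2]
  exact h1.limsup_eq.symm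

/-! ### Polar coordinates and integrability of powers of the norm -/

theorem measureReal_ball_E3 : volume.real (Metric.ball (0 : E3) 1) = Real.pi * 4 / 3 := by
  rw [measureReal_def, EuclideanSpace.volume_ball_fin_three]
  simp only [ENNReal.ofReal_one, one_pow, one_mul]
  exact ENNReal.toReal_ofReal (by positivity)

theorem integral_radial_E3 (f : ℝ → ℝ) :
    ∫ x : E3, f ‖x‖ = 4 * Real.pi * ∫ r in Ioi (0 : ℝ), r ^ 2 * f r := by
  rw [integral_fun_norm_addHaar volume f, finrank_E3, measureReal_ball_E3]
  simp only [nsmul_eq_mul, smul_eq_mul]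
  push_cast
  ring

theorem integrable_radial_E3 {f : ℝ → ℝ} :
    Integrable (fun x : E3 => f ‖x‖) ↔ IntegrableOn (fun r => r ^ 2 * f r) (Ioi 0) := by
  rw [integrable_fun_norm_addHaar volume, finrank_E3]
  rfl

theorem integral_radial_complex (f : ℝ → ℝ) :
    ∫ x : ℂ, f ‖x‖ = 2 * Real.pi * ∫ r in Ioi (0 : ℝ), r * f r := by
  rw [integral_fun_norm_addHaar volume f, Complex.finrank_real_complex, measureReal_def,
    Complex.volume_ball]
  simp [mul_assoc]

/-- Powers of the norm larger than `-3` are integrable on balls of `ℝ³`. -/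
theorem integrableOn_rpow_norm_ball {s : ℝ} (hs : -3 < s) (R : ℝ) :
    IntegrableOn (fun x : E3 => ‖x‖ ^ s) (Metric.ball 0 R) := by
  rw [integrableOn_fun_norm_addHaar volume (f := fun r => r ^ s), finrank_E3]
  rcases le_or_gt R 0 with hR | hR
  · simp [Ioo_eq_empty (not_lt.2 hR)]
  have h := (intervalIntegral.intervalIntegrable_rpow' (a := 0) (b := R)
    (show -1 < s + 2 by linarith))
  rw [intervalIntegrable_iff_integrableOn_Ioo_of_le hR.le] at h
  refine h.congr_fun (fun r hr => ?_) measurableSet_Ioo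
  simp only [smul_eq_mul]
  rw [Real.rpow_add hr.1]
  norm_num
  ring

theorem locallyIntegrable_rpow_norm {s : ℝ} (hs : -3 < s) :
    LocallyIntegrable (fun x : E3 => ‖x‖ ^ s) volume := by
  intro x
  refine ⟨Metric.ball 0 (‖x‖ + 1), Metric.isOpen_ball.mem_nhds (by simp), ?_⟩
  exact integrableOn_rpow_norm_ball hs _

/-- Powers of the norm smaller than `-3` are integrable away from the origin. -/
theorem integrableOn_rpow_norm_compl_ball {s : ℝ} (hs : s < -3) {R : ℝ} (hR : 0 < R) :
    IntegrableOn (fun x : E3 => ‖x‖ ^ s) (Metric.ball 0 R)ᶜ := by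
  rw [← integrable_indicator_iff Metric.isOpen_ball.measurableSet.compl]
  have : (Metric.ball (0 : E3) R)ᶜ.indicator (fun x : E3 => ‖x‖ ^ s) =
      fun x => (Ici R).indicator (fun r => r ^ s) ‖x‖ := by
    ext x; simp [indicator]
  rw [this, integrable_radial_E3]
  have h := (integrableOn_Ioi_rpow_of_lt (show s + 2 < -1 by linarith) hR)
  rw [← integrableOn_Ici_iff_integrableOn_Ioi, ← integrable_indicator_iff measurableSet_Ici] at h
  refine (h.congr (Eventually.of_forall fun r => ?_)).integrableOn
  by_cases hr : r ∈ Ici R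
  · simp only [indicator_of_mem hr]
    rw [Real.rpow_add (hR.trans_le hr)]
    norm_num
    ring
  · simp [indicator_of_notMem hr]

/-- The inverse cube of the norm is not integrable near infinity. -/
theorem not_integrableOn_inv_norm_cube {R : ℝ} (hR : 0 < R) :
    ¬ IntegrableOn (fun x : E3 => (‖x‖ ^ 3)⁻¹) (Metric.ball 0 R)ᶜ := by
  rw [← integrable_indicator_iff Metric.isOpen_ball.measurableSet.compl]
  have : (Metric.ball (0 : E3) R)ᶜ.indicator (fun x : E3 => (‖x‖ ^ 3)⁻¹) =
      fun x => (Ici R).indicator (fun r => (r ^ 3)⁻¹) ‖x‖ := by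
    ext x; simp [indicator]
  rw [this, integrable_radial_E3]
  intro h
  refine not_integrableOn_Ioi_inv (a := R) ?_
  refine (h.mono_set (Ioi_subset_Ioi hR.le)).congr_fun (fun r hr => ?_) measurableSet_Ioi
  have hr' : R < r := hr
  have hr0 : r ≠ 0 := (hR.trans hr').ne'
  simp only [indicator_of_mem (show r ∈ Ici R from hr'.le)]
  field_simp

/-! ### Newton's shell theorem -/

theorem integral_mul_inv_sqrt {c t : ℝ} (hc : 0 < c) :
    ∫ s in (0 : ℝ)..t, s * (√(c ^ 2 + s ^ 2))⁻¹ = √(c ^ 2 + t ^ 2) - c := by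
  have hd : ∀ s ∈ uIcc 0 t, HasDerivAt (fun s => √(c ^ 2 + s ^ 2)) (s * (√(c ^ 2 + s ^ 2))⁻¹) s := by
    intro s _
    have h1 : HasDerivAt (fun s => c ^ 2 + s ^ 2) (2 * s) s := by
      simpa using (hasDerivAt_pow 2 s).const_add (c ^ 2)
    have h2 := h1.sqrt (by positivity)
    refine h2.congr_deriv ?_
    have : √(c ^ 2 + s ^ 2) ≠ 0 := by positivity
    field_simp
  rw [intervalIntegral.integral_eq_sub_of_hasDerivAt hd]
  · simp [Real.sqrt_sq hc.le]
  · apply ContinuousOn.intervalIntegrable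
    refine continuousOn_id.mul (ContinuousOn.inv₀ (by fun_prop) fun s _ => ?_)
    positivity

/-- The potential of a uniform disc at height `c` on its axis. -/
theorem integral_disc_potential {c b : ℝ} (hc : 0 < c) (hb : 0 ≤ b) :
    ∫ w : ℂ, (Iio b).indicator (fun s => (√(c ^ 2 + s ^ 2))⁻¹) ‖w‖ =
      2 * Real.pi * (√(c ^ 2 + b ^ 2) - c) := by
  rw [integral_radial_complex, ← integral_mul_inv_sqrt hc,
    intervalIntegral.integral_of_le hb, ← integral_indicator measurableSet_Ioi,
    ← integral_indicator measurableSet_Ioc]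
  congr 1
  refine integral_congr_ae ?_
  filter_upwards [compl_mem_ae_iff.2 (measure_singleton b)] with s hs
  have hs' : s ≠ b := hs
  by_cases h0 : 0 < s
  · by_cases h1 : s < b
    · simp [indicator, h0, h1, h1.le]
    · have : ¬ s ≤ b := fun h => h1 (lt_of_le_of_ne h hs')
      simp [indicator, h0, h1, this]
  · simp [indicator, h0]

theorem integral_sqrt_sub_linear {a R : ℝ} (ha : 0 < a) (hR : 0 < R) :
    ∫ z in (-R)..R, √(R ^ 2 + a ^ 2 - 2 * a * z) = ((R + a) ^ 3 - |R - a| ^ 3) / (3 * a) := by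
  have hpos : ∀ z ∈ Icc (-R) R, 0 ≤ R ^ 2 + a ^ 2 - 2 * a * z := fun z hz => by
    nlinarith [hz.2, sq_nonneg (R - a)]
  have key := intervalIntegral.integral_eq_sub_of_hasDerivAt_of_le
    (a := -R) (b := R) (f := fun z => -(1 / (3 * a)) * √(R ^ 2 + a ^ 2 - 2 * a * z) ^ 3)
    (f' := fun z => √(R ^ 2 + a ^ 2 - 2 * a * z)) (by linarith) (by fun_prop) ?_ ?_
  · rw [key]
    have e1 : R ^ 2 + a ^ 2 - 2 * a * R = (R - a) ^ 2 := by ring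
    have e2 : R ^ 2 + a ^ 2 - 2 * a * -R = (R + a) ^ 2 := by ring
    simp only [e1, e2, Real.sqrt_sq_eq_abs, abs_of_pos (show 0 < R + a by linarith)]
    field_simp
    ring
  · intro z hz
    have hz' : 0 < R ^ 2 + a ^ 2 - 2 * a * z := by nlinarith [hz.2, sq_nonneg (R - a)]
    have h1 : HasDerivAt (fun z => R ^ 2 + a ^ 2 - 2 * a * z) (-(2 * a)) z := by
      simpa using ((hasDerivAt_id z).const_mul (2 * a)).const_sub (R ^ 2 + a ^ 2)
    have h2 := ((h1.sqrt hz'.ne').pow 3).const_mul (-(1 / (3 * a)))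
    refine h2.congr_deriv ?_
    have : √(R ^ 2 + a ^ 2 - 2 * a * z) ≠ 0 := by positivity
    push_cast
    field_simp
  · exact Continuous.intervalIntegrable (by fun_prop) _ _

theorem integral_abs_sub {a R : ℝ} (ha : 0 ≤ a) (hR : 0 < R) :
    ∫ z in (-R)..R, |z - a| = if a < R then a ^ 2 + R ^ 2 else 2 * R * a := by
  have hl : ∀ u v : ℝ, u ≤ v → v ≤ a → ∫ z in u..v, |z - a| = (a - u) ^ 2 / 2 - (a - v) ^ 2 / 2 := by
    intro u v huv hv
    rw [intervalIntegral.integral_congr (g := fun z => a - z)]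
    · rw [intervalIntegral.integral_sub (by simp) (by simp), integral_id,
        intervalIntegral.integral_const, smul_eq_mul]
      ring
    · intro z hz
      rw [uIcc_of_le huv] at hz
      simp only
      rw [abs_of_nonpos (by linarith [hz.2])]; ring
  have hr : ∀ u v : ℝ, u ≤ v → a ≤ u → ∫ z in u..v, |z - a| = (v - a) ^ 2 / 2 - (u - a) ^ 2 / 2 := by
    intro u v huv hv
    rw [intervalIntegral.integral_congr (g := fun z => z - a)]
    · rw [intervalIntegral.integral_sub (by simp) (by simp), integral_id,
        intervalIntegral.integral_const, smul_eq_mul]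
      ring
    · intro z hz
      rw [uIcc_of_le huv] at hz
      simp only
      rw [abs_of_nonneg (by linarith [hz.1])]
  split_ifs with h
  · rw [← intervalIntegral.integral_add_adjacent_intervals (b := a)
      (Continuous.intervalIntegrable (by fun_prop) _ _)
      (Continuous.intervalIntegrable (by fun_prop) _ _), hl _ _ (by linarith) le_rfl,
      hr _ _ h.le le_rfl]
    ring
  · rw [hl _ _ (by linarith) (not_lt.1 h)]
    ring

theorem integrableOn_inv_norm_sub_ball (x : E3) (R : ℝ) :
    IntegrableOn (fun y => ‖x - y‖⁻¹) (Metric.ball 0 R) := by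
  have h := integrableOn_rpow_norm_ball (show (-3 : ℝ) < -1 by norm_num) (R + ‖x‖)
  rw [← integrable_indicator_iff Metric.isOpen_ball.measurableSet] at h
  have h2 := (h.comp_sub_left x)
  have h3 : IntegrableOn (fun y => ‖x - y‖⁻¹) (Metric.ball x (R + ‖x‖)) := by
    rw [← integrable_indicator_iff Metric.isOpen_ball.measurableSet]
    refine h2.congr (Eventually.of_forall fun y => ?_)
    simp [indicator, dist_eq_norm, norm_sub_rev, Real.rpow_neg_one]
  refine h3.mono_set fun y hy => ?_
  rw [Metric.mem_ball, dist_eq_norm] at *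
  have := norm_sub_le y x
  simp at hy
  linarith

/-- Slicing orthogonally to `x` turns the ball into discs and `x` into a point on their common axis,
where the disc potential is explicit. The value is left unsimplified so that it matches
`integral_inv_max_norm_ball` syntactically. -/
theorem integral_inv_norm_sub_ball {x : E3} (hx : x ≠ 0) {R : ℝ} (hR : 0 < R) :
    ∫ y in Metric.ball 0 R, ‖x - y‖⁻¹ = 2 * Real.pi *
      (((R + ‖x‖) ^ 3 - |R - ‖x‖| ^ 3) / (3 * ‖x‖) -
        if ‖x‖ < R then ‖x‖ ^ 2 + R ^ 2 else 2 * R * ‖x‖) := by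
  set a := ‖x‖ with ha_def
  have ha : 0 < a := norm_pos_iff.2 hx
  have hfr : Module.finrank ℝ (WithLp 2 (ℝ × ℂ)) = Module.finrank ℝ E3 := by
    rw [finrank_E3, LinearEquiv.finrank_eq (WithLp.linearEquiv 2 ℝ (ℝ × ℂ))]
    simp
  -- Coordinates `(z, w)`: height along the direction of `x`, and a complex coordinate in the
  -- orthogonal plane. Composing with a rotation puts `x` at `(a, 0)`.
  let e0 : WithLp 2 (ℝ × ℂ) ≃ₗᵢ[ℝ] E3 :=
    (stdOrthonormalBasis ℝ (WithLp 2 (ℝ × ℂ))).equiv (stdOrthonormalBasis ℝ E3)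
      (finCongr hfr)
  have hn : ‖e0 (WithLp.toLp 2 (a, 0))‖ = ‖x‖ := by
    rw [LinearIsometryEquiv.norm_map, WithLp.prod_norm_eq_of_L2]
    simp [abs_of_pos ha, Real.sqrt_sq ha.le, ← ha_def]
  obtain ⟨A, -, hA⟩ := exists_rotation_map_eq hn
  let e : WithLp 2 (ℝ × ℂ) ≃ₗᵢ[ℝ] E3 := e0.trans A
  have hex : e (WithLp.toLp 2 (a, 0)) = x := hA
  have hmp : MeasurePreserving (fun p : ℝ × ℂ => e (WithLp.toLp 2 p)) volume volume :=
    e.measurePreserving.comp (WithLp.volume_preserving_toLp ℝ ℂ)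
  have hemb : MeasurableEmbedding (fun p : ℝ × ℂ => e (WithLp.toLp 2 p)) :=
    e.toHomeomorph.measurableEmbedding.comp
      (MeasurableEquiv.toLp 2 (ℝ × ℂ)).measurableEmbedding
  have hsq : ∀ p : ℝ × ℂ, ‖e (WithLp.toLp 2 p)‖ = √(p.1 ^ 2 + ‖p.2‖ ^ 2) := by
    intro p
    rw [LinearIsometryEquiv.norm_map, WithLp.prod_norm_eq_of_L2]
    simp
  have hsub : ∀ p : ℝ × ℂ, ‖x - e (WithLp.toLp 2 p)‖ = √((p.1 - a) ^ 2 + ‖p.2‖ ^ 2) := by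
    intro p
    rw [← hex, ← map_sub, ← WithLp.toLp_sub, hsq]
    simp only [Prod.fst_sub, Prod.snd_sub, zero_sub, norm_neg]
    congr 2
    ring
  let F : E3 → ℝ := (Metric.ball 0 R).indicator fun y => ‖x - y‖⁻¹
  have hFi : Integrable F := by
    rw [integrable_indicator_iff Metric.isOpen_ball.measurableSet]
    exact integrableOn_inv_norm_sub_ball x R
  rw [← integral_indicator Metric.isOpen_ball.measurableSet, ← hmp.integral_comp hemb]
  have hFi2 : Integrable (fun p : ℝ × ℂ => F (e (WithLp.toLp 2 p))) (volume.prod volume) :=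
    hmp.integrable_comp_of_integrable hFi
  change ∫ p : ℝ × ℂ, F (e (WithLp.toLp 2 p)) ∂(volume.prod volume) = _
  rw [integral_prod _ hFi2]
  have hinner : ∀ z : ℝ, z ≠ a → ∫ w : ℂ, F (e (WithLp.toLp 2 (z, w))) =
      (Ioc (-R) R).indicator
        (fun z => 2 * Real.pi * (√(R ^ 2 + a ^ 2 - 2 * a * z) - |z - a|)) z := by
    intro z hz
    by_cases hzR : z ^ 2 < R ^ 2
    · have hmem : z ∈ Ioc (-R) R := by
        have := abs_lt_of_sq_lt_sq hzR hR.le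
        exact ⟨(abs_lt.1 this).1, (abs_lt.1 this).2.le⟩
      rw [indicator_of_mem hmem]
      have h1 : ∀ w : ℂ, F (e (WithLp.toLp 2 (z, w))) =
          (Iio √(R ^ 2 - z ^ 2)).indicator (fun s => (√(|z - a| ^ 2 + s ^ 2))⁻¹) ‖w‖ := by
        intro w
        have hiff : e (WithLp.toLp 2 (z, w)) ∈ Metric.ball (0 : E3) R ↔
            ‖w‖ ∈ Iio √(R ^ 2 - z ^ 2) := by
          rw [mem_ball_zero_iff, hsq, mem_Iio, Real.sqrt_lt' hR, Real.lt_sqrt (norm_nonneg _)]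
          constructor <;> intro h <;> simp only at * <;> linarith
        by_cases hw : ‖w‖ ∈ Iio √(R ^ 2 - z ^ 2)
        · rw [indicator_of_mem hw]
          simp only [F]
          rw [indicator_of_mem (hiff.2 hw), hsub, sq_abs]
        · rw [indicator_of_notMem hw]
          simp only [F]
          rw [indicator_of_notMem (fun h => hw (hiff.1 h))]
      simp_rw [h1]
      rw [integral_disc_potential (abs_pos.2 (sub_ne_zero.2 hz)) (Real.sqrt_nonneg _),
        Real.sq_sqrt (by linarith), sq_abs]
      rw [show (z - a) ^ 2 + (R ^ 2 - z ^ 2) = R ^ 2 + a ^ 2 - 2 * a * z by ring]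
    · have h1 : ∀ w : ℂ, F (e (WithLp.toLp 2 (z, w))) = 0 := by
        intro w
        simp only [F]
        rw [indicator_of_notMem]
        rw [mem_ball_zero_iff, hsq, not_lt]
        apply Real.le_sqrt_of_sq_le
        simp only
        nlinarith [sq_nonneg ‖w‖]
      simp_rw [h1, integral_zero]
      -- The half-open interval contains the degenerate slice `z = R`, where the disc is empty and
      -- the formula also gives zero.
      by_cases hmem : z ∈ Ioc (-R) R
      · have hzR' : z = R := by
          by_contra hne
          have := lt_of_le_of_ne hmem.2 hne
          exact hzR (sq_lt_sq' hmem.1 this)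
        rw [indicator_of_mem hmem, hzR']
        have : R ^ 2 + a ^ 2 - 2 * a * R = (R - a) ^ 2 := by ring
        rw [this, Real.sqrt_sq_eq_abs]
        ring
      · rw [indicator_of_notMem hmem]
  have hae : ∀ᵐ z : ℝ, z ≠ a := compl_mem_ae_iff.2 (measure_singleton a)
  rw [integral_congr_ae (hae.mono fun z hz => hinner z hz),
    integral_indicator measurableSet_Ioc, ← intervalIntegral.integral_of_le (by linarith),
    intervalIntegral.integral_const_mul, intervalIntegral.integral_sub
      (Continuous.intervalIntegrable (by fun_prop) _ _)
      (Continuous.intervalIntegrable (by fun_prop) _ _),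
    integral_sqrt_sub_linear ha hR, integral_abs_sub ha.le hR]

theorem integral_inv_max_norm_ball {a : ℝ} (ha : 0 < a) {R : ℝ} (hR : 0 < R) :
    ∫ y in Metric.ball (0 : E3) R, (max a ‖y‖)⁻¹ = 2 * Real.pi *
      (((R + a) ^ 3 - |R - a| ^ 3) / (3 * a) -
        if a < R then a ^ 2 + R ^ 2 else 2 * R * a) := by
  rw [← integral_indicator Metric.isOpen_ball.measurableSet]
  have : (Metric.ball (0 : E3) R).indicator (fun y : E3 => (max a ‖y‖)⁻¹) =
      fun x => (Iio R).indicator (fun r => (max a r)⁻¹) ‖x‖ := by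
    ext x; simp [indicator]
  rw [this, integral_radial_E3]
  have h1 : ∫ r in Ioi (0 : ℝ), r ^ 2 * (Iio R).indicator (fun r => (max a r)⁻¹) r =
      ∫ r in (0 : ℝ)..R, r ^ 2 * (max a r)⁻¹ := by
    rw [intervalIntegral.integral_of_le hR.le, integral_Ioc_eq_integral_Ioo,
      ← integral_indicator measurableSet_Ioi, ← integral_indicator measurableSet_Ioo]
    congr 1
    ext r
    by_cases h0 : 0 < r <;> by_cases h1 : r < R <;> simp [indicator, h0, h1]
  have hcont : Continuous fun r => r ^ 2 * (max a r)⁻¹ :=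
    (continuous_pow 2).mul (Continuous.inv₀ (by fun_prop) fun r => (lt_max_of_lt_left ha).ne')
  have hl : ∀ v, 0 ≤ v → v ≤ a → ∫ r in (0 : ℝ)..v, r ^ 2 * (max a r)⁻¹ = v ^ 3 / (3 * a) := by
    intro v hv hva
    rw [intervalIntegral.integral_congr (g := fun r => r ^ 2 * a⁻¹)]
    · simp
      field_simp
      norm_num
    · intro r hr
      rw [uIcc_of_le hv] at hr
      simp only
      rw [max_eq_left (hr.2.trans hva)]
  rw [h1]
  split_ifs with h
  · rw [← intervalIntegral.integral_add_adjacent_intervals (b := a)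
      (hcont.intervalIntegrable _ _) (hcont.intervalIntegrable _ _), hl a ha.le le_rfl,
      intervalIntegral.integral_congr (g := fun r => r), abs_of_pos (by linarith)]
    · simp
      field_simp
      ring
    · intro r hr
      rw [uIcc_of_le h.le] at hr
      have : 0 < r := ha.trans_le hr.1
      simp only
      rw [max_eq_right hr.1]
      field_simp
  · rw [hl R hR.le (not_lt.1 h), abs_of_nonpos (by linarith [not_lt.1 h])]
    field_simp
    ring

/-- **Newton's shell theorem** for balls. -/
theorem integral_inv_norm_sub_ball_eq (x : E3) (R : ℝ) :
    ∫ y in Metric.ball 0 R, ‖x - y‖⁻¹ = ∫ y in Metric.ball (0 : E3) R, (max ‖x‖ ‖y‖)⁻¹ := by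
  rcases le_or_gt R 0 with hR | hR
  · simp [Metric.ball_eq_empty.2 hR]
  rcases eq_or_ne x 0 with rfl | hx
  · simp
  · rw [integral_inv_norm_sub_ball hx hR, integral_inv_max_norm_ball (norm_pos_iff.2 hx) hR]

theorem integrableOn_inv_max_norm_ball (x : E3) (R : ℝ) :
    IntegrableOn (fun y : E3 => (max ‖x‖ ‖y‖)⁻¹) (Metric.ball 0 R) := by
  have h := integrableOn_rpow_norm_ball (show (-3 : ℝ) < -1 by norm_num) R
  refine h.mono' (Measurable.aestronglyMeasurable (by fun_prop)) (ae_restrict_of_ae ?_)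
  have hae : ∀ᵐ y : E3, y ≠ 0 := compl_mem_ae_iff.2 (measure_singleton 0)
  filter_upwards [hae] with y hy
  rw [Real.rpow_neg_one, Real.norm_of_nonneg (by positivity)]
  gcongr
  exact le_max_right _ _

/-- **Newton's shell theorem**: the potential of a radial density. -/
theorem lintegral_radial_mul_inv_norm_sub (x : E3) {h : ℝ → ℝ≥0∞} (hh : Measurable h) :
    ∫⁻ y : E3, h ‖y‖ * ENNReal.ofReal ‖x - y‖⁻¹ =
      ∫⁻ y : E3, h ‖y‖ * ENNReal.ofReal (max ‖x‖ ‖y‖)⁻¹ := by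
  -- Both kernels, taken as densities and pushed forward by the norm, give measures on the line that
  -- agree on the half-lines `Iio R` by the case of balls. These form a π-system, so the measures
  -- coincide.
  let κ₁ : E3 → ℝ≥0∞ := fun y => ENNReal.ofReal ‖x - y‖⁻¹
  let κ₂ : E3 → ℝ≥0∞ := fun y => ENNReal.ofReal (max ‖x‖ ‖y‖)⁻¹
  have hκ₁ : Measurable κ₁ := by fun_prop
  have hκ₂ : Measurable κ₂ := by fun_prop
  let μ₁ : Measure ℝ := (volume.withDensity κ₁).map norm
  let μ₂ : Measure ℝ := (volume.withDensity κ₂).map norm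
  have hpre : ∀ R : ℝ, (norm : E3 → ℝ) ⁻¹' Iio R = Metric.ball 0 R := by
    intro R; ext y; simp
  have e1 : ∀ R, μ₁ (Iio R) = ENNReal.ofReal (∫ y in Metric.ball 0 R, ‖x - y‖⁻¹) := by
    intro R
    rw [Measure.map_apply measurable_norm measurableSet_Iio, hpre,
      withDensity_apply _ Metric.isOpen_ball.measurableSet,
      ofReal_integral_eq_lintegral_ofReal (integrableOn_inv_norm_sub_ball x R)
        (Eventually.of_forall fun y => by positivity)]
  have e2 : ∀ R, μ₂ (Iio R) =
      ENNReal.ofReal (∫ y in Metric.ball (0 : E3) R, (max ‖x‖ ‖y‖)⁻¹) := by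
    intro R
    rw [Measure.map_apply measurable_norm measurableSet_Iio, hpre,
      withDensity_apply _ Metric.isOpen_ball.measurableSet,
      ofReal_integral_eq_lintegral_ofReal (integrableOn_inv_max_norm_ball x R)
        (Eventually.of_forall fun y => by positivity)]
  have hμ : μ₁ = μ₂ := by
    refine Measure.ext_of_generateFrom_of_iUnion (range Iio) (fun n : ℕ => Iio (n : ℝ))
      (borel_eq_generateFrom_Iio ℝ ▸ BorelSpace.measurable_eq) isPiSystem_Iio ?_ ?_ ?_ ?_
    · exact iUnion_eq_univ_iff.2 fun r => exists_nat_gt r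
    · exact fun n => mem_range_self _
    · exact fun n => by rw [e1]; exact ENNReal.ofReal_ne_top
    · rintro _ ⟨R, rfl⟩
      rw [e1, e2, integral_inv_norm_sub_ball_eq]
  have hl : ∀ κ : E3 → ℝ≥0∞, Measurable κ →
      ∫⁻ y : E3, h ‖y‖ * κ y = ∫⁻ r, h r ∂((volume.withDensity κ).map norm) := by
    intro κ hκ
    rw [lintegral_map hh measurable_norm,
      lintegral_withDensity_eq_lintegral_mul (f := κ) _ hκ
        (g := fun y : E3 => h ‖y‖) (hh.comp measurable_norm)]
    simp [mul_comm]
  rw [hl κ₁ hκ₁, hl κ₂ hκ₂]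
  exact congrArg (fun μ => ∫⁻ r, h r ∂μ) hμ

/-- The kernel `1 / max ‖x‖ ‖y‖` is at most `1 / ‖x‖` and Lipschitz in `x` for fixed `y ≠ 0`, which
makes the Fubini and integration by parts arguments below elementary. Passing through `lintegral`
gives the identity at every `x` without checking integrability in `y`. -/
theorem newtonPotential_eq {ρ : E3 → ℝ} (hi : Integrable ρ) (hs : SphericallySymmetric ρ)
    (h0 : ∀ᵐ x, 0 ≤ ρ x) (x : E3) :
    newtonPotential ρ x = -∫ y, ρ y * (max ‖x‖ ‖y‖)⁻¹ := by
  obtain ⟨g, hg, hρ⟩ := hs.exists_radial hi.locallyIntegrable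
  have key : ∀ κ : E3 → ℝ, Measurable κ → (∀ y, 0 ≤ κ y) → ∫ y, ρ y * κ y =
      (∫⁻ y : E3, ENNReal.ofReal (g ‖y‖) * ENNReal.ofReal (κ y)).toReal := by
    intro κ hκ hκ0
    rw [integral_eq_lintegral_of_nonneg_ae
      (h0.mono fun y hy => mul_nonneg hy (hκ0 y))
      (hi.aestronglyMeasurable.mul hκ.aestronglyMeasurable)]
    congr 1
    refine lintegral_congr_ae ?_
    filter_upwards [hρ] with y hy
    rw [ENNReal.ofReal_mul' (hκ0 y), hy]
  simp only [newtonPotential, div_eq_mul_inv]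
  rw [key _ (by fun_prop) (fun y => by positivity), key _ (by fun_prop) (fun y => by positivity),
    lintegral_radial_mul_inv_norm_sub x (h := fun r => ENNReal.ofReal (g r)) (by fun_prop)]

/-! ### The weak gradient of the Newtonian potential -/

theorem lipschitzWith_inv_max_norm {s : ℝ} (hs : 0 < s) :
    LipschitzWith (Real.toNNReal (s ^ 2)⁻¹) fun x : E3 => (max ‖x‖ s)⁻¹ := by
  refine LipschitzWith.of_dist_le_mul fun x y => ?_
  have hx : s ≤ max ‖x‖ s := le_max_right _ _
  have hy : s ≤ max ‖y‖ s := le_max_right _ _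
  have hx0 := hs.trans_le hx
  have hy0 := hs.trans_le hy
  rw [Real.coe_toNNReal _ (by positivity), Real.dist_eq, inv_sub_inv hx0.ne' hy0.ne', abs_div,
    abs_of_pos (mul_pos hx0 hy0), div_eq_inv_mul]
  gcongr
  · nlinarith
  · calc |max ‖y‖ s - max ‖x‖ s| ≤ |‖y‖ - ‖x‖| := by
          simpa using abs_max_sub_max_le_abs ‖y‖ ‖x‖ s
      _ ≤ dist x y := by rw [dist_eq_norm, norm_sub_rev]; exact abs_norm_sub_norm_le y x

theorem hasFDerivAt_inv_norm {x : E3} (hx : x ≠ 0) :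
    HasFDerivAt (fun x : E3 => ‖x‖⁻¹) (-(‖x‖ ^ 3)⁻¹ • innerSL ℝ x) x := by
  have hx0 : 0 < ‖x‖ := norm_pos_iff.2 hx
  have h1 : HasFDerivAt (fun x : E3 => ‖x‖ ^ 2) (2 • innerSL ℝ x) x :=
    (hasStrictFDerivAt_norm_sq x).hasFDerivAt
  have h2 := h1.sqrt (by positivity)
  have h3 : HasFDerivAt (fun x : E3 => ‖x‖) ((1 / (2 * √(‖x‖ ^ 2))) • 2 • innerSL ℝ x) x := by
    refine h2.congr_of_eventuallyEq (Eventually.of_forall fun y => ?_)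
    simp
  have h4 := (hasDerivAt_inv hx0.ne').comp_hasFDerivAt x h3
  refine h4.congr_fderiv ?_
  ext v
  simp only [Real.sqrt_sq hx0.le, smul_apply, smul_eq_mul, nsmul_eq_mul]
  push_cast
  field_simp

theorem lineDeriv_inv_max_norm {s : ℝ} {x : E3} (hx : ‖x‖ ≠ s) (hs : 0 < s) (v : E3) :
    lineDeriv ℝ (fun x : E3 => (max ‖x‖ s)⁻¹) x v =
      -{x : E3 | s < ‖x‖}.indicator (fun x => inner ℝ x v / ‖x‖ ^ 3) x := by
  rcases lt_or_gt_of_ne hx with h | h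
  · have hev : (fun x : E3 => (max ‖x‖ s)⁻¹) =ᶠ[𝓝 x] fun _ => s⁻¹ := by
      filter_upwards [continuous_norm.continuousAt.eventually_lt_const h] with y hy
      rw [max_eq_right hy.le]
    have hd : HasFDerivAt (fun x : E3 => (max ‖x‖ s)⁻¹) (0 : E3 →L[ℝ] ℝ) x :=
      (hasFDerivAt_const s⁻¹ x).congr_of_eventuallyEq hev
    rw [(hd.hasLineDerivAt v).lineDeriv]
    simp [indicator, not_lt.2 h.le]
  · have hev : (fun x : E3 => (max ‖x‖ s)⁻¹) =ᶠ[𝓝 x] fun x => ‖x‖⁻¹ := by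
      filter_upwards [continuous_norm.continuousAt.eventually_const_lt h] with y hy
      rw [max_eq_left hy.le]
    have hx0 : x ≠ 0 := norm_pos_iff.1 (hs.trans h)
    have hd := (hasFDerivAt_inv_norm hx0).congr_of_eventuallyEq hev
    rw [(hd.hasLineDerivAt v).lineDeriv, indicator_of_mem (show x ∈ {x : E3 | s < ‖x‖} from h)]
    simp
    ring

/-- Integration by parts for the potential of a single shell of radius `s`: it is Lipschitz, and
differentiable off the null sphere `‖x‖ = s`. Inside the shell there is no force, whence the
indicator. -/
theorem integral_inv_max_norm_mul_fderiv {s : ℝ} (hs : 0 < s) {φ : E3 → ℝ}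
    (hφ : ContDiff ℝ ∞ φ) (hc : HasCompactSupport φ) (v : E3) :
    ∫ x : E3, (max ‖x‖ s)⁻¹ * fderiv ℝ φ x v =
      ∫ x, {x : E3 | s < ‖x‖}.indicator (fun x => inner ℝ x v / ‖x‖ ^ 3) x * φ x := by
  obtain ⟨D, hD⟩ := (hφ.of_le (m := 1) (by simp)).lipschitzWith_of_hasCompactSupport hc
    one_ne_zero
  have key := (lipschitzWith_inv_max_norm hs).integral_lineDeriv_mul_eq (μ := volume) hD hc v
  have h1 : ∀ x : E3, lineDeriv ℝ φ x (-v) * (max ‖x‖ s)⁻¹ =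
      -((max ‖x‖ s)⁻¹ * fderiv ℝ φ x v) := by
    intro x
    rw [((hφ.differentiable (by simp)) x).lineDeriv_eq_fderiv, map_neg]
    ring
  have h2 : ∀ᵐ x : E3, lineDeriv ℝ (fun x : E3 => (max ‖x‖ s)⁻¹) x v * φ x =
      -({x : E3 | s < ‖x‖}.indicator (fun x => inner ℝ x v / ‖x‖ ^ 3) x * φ x) := by
    have hae : ∀ᵐ x : E3, x ∉ Metric.sphere (0 : E3) s :=
      compl_mem_ae_iff.2 (Measure.addHaar_sphere _ _ _)
    filter_upwards [hae] with x hx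
    rw [lineDeriv_inv_max_norm (by simpa using hx) hs]
    ring
  simp_rw [h1] at key
  rw [integral_congr_ae h2, integral_neg, integral_neg, neg_inj] at key
  exact key.symm

/-- The mass inside the ball of radius `r`. -/
noncomputable def massIn (ρ : E3 → ℝ) (r : ℝ) : ℝ := ∫ y in Metric.ball 0 r, ρ y

/-- The gravitational field of a radial density with mass function `m`. -/
noncomputable def radialField (m : ℝ → ℝ) (x : E3) : E3 := (m ‖x‖ / ‖x‖ ^ 3) • x

theorem norm_radialField {m : ℝ → ℝ} {x : E3} (hm : 0 ≤ m ‖x‖) :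
    ‖radialField m x‖ = m ‖x‖ / ‖x‖ ^ 2 := by
  rcases eq_or_ne x 0 with rfl | hx
  · simp [radialField]
  have := norm_pos_iff.2 hx
  rw [radialField, norm_smul, Real.norm_of_nonneg (by positivity)]
  field_simp

theorem measurable_radialField {m : ℝ → ℝ} (hm : Measurable m) : Measurable (radialField m) := by
  exact Measurable.smul ((hm.comp measurable_norm).div (measurable_norm.pow_const 3))
    measurable_id

section

variable {ρ : E3 → ℝ}

theorem massIn_nonneg (h0 : ∀ᵐ x, 0 ≤ ρ x) (r : ℝ) : 0 ≤ massIn ρ r :=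
  setIntegral_nonneg_of_ae h0

theorem massIn_mono (hi : Integrable ρ) (h0 : ∀ᵐ x, 0 ≤ ρ x) : Monotone (massIn ρ) :=
  fun _ _ h => setIntegral_mono_set hi.integrableOn (ae_restrict_of_ae h0)
    (Metric.ball_subset_ball h).eventuallyLE

theorem massIn_le (hi : Integrable ρ) (h0 : ∀ᵐ x, 0 ≤ ρ x) (r : ℝ) : massIn ρ r ≤ ∫ x, ρ x :=
  setIntegral_le_integral hi h0

theorem tendsto_massIn_atTop (hi : Integrable ρ) :
    Tendsto (massIn ρ) atTop (𝓝 (∫ x, ρ x)) := by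
  have : (⋃ r : ℝ, Metric.ball (0 : E3) r) = univ :=
    iUnion_eq_univ_iff.2 fun x => ⟨‖x‖ + 1, by simp⟩
  have h := tendsto_setIntegral_of_monotone (μ := volume) (f := ρ)
    (s := fun r : ℝ => Metric.ball (0 : E3) r)
    (fun r => Metric.isOpen_ball.measurableSet) (fun _ _ h => Metric.ball_subset_ball h)
    hi.integrableOn
  rw [this, setIntegral_univ] at h
  exact h

theorem locallyIntegrable_radialField (hi : Integrable ρ) (h0 : ∀ᵐ x, 0 ≤ ρ x) :
    LocallyIntegrable (radialField (massIn ρ)) volume := by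
  refine (LocallyIntegrable.smul (locallyIntegrable_rpow_norm (show (-3 : ℝ) < -2 by norm_num))
    (∫ x, ρ x)).mono
    (measurable_radialField (massIn_mono hi h0).measurable).aestronglyMeasurable
    (Eventually.of_forall fun x => ?_)
  rw [norm_radialField (massIn_nonneg h0 _)]
  refine le_trans ?_ (Real.le_norm_self _)
  rw [Pi.smul_apply, smul_eq_mul, Real.rpow_neg (norm_nonneg _), div_eq_mul_inv]
  norm_cast
  gcongr
  exact massIn_le hi h0 _

theorem inv_max_norm_le {x y : E3} (hx : x ≠ 0) : (max ‖x‖ ‖y‖)⁻¹ ≤ ‖x‖⁻¹ := by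
  have := norm_pos_iff.2 hx
  gcongr
  exact le_max_left _ _

theorem aestronglyMeasurable_mul_inv_max_norm (hi : Integrable ρ) :
    AEStronglyMeasurable (fun p : E3 × E3 => ρ p.2 * (max ‖p.1‖ ‖p.2‖)⁻¹)
      (volume.prod volume) :=
  hi.aestronglyMeasurable.comp_snd.mul (Measurable.aestronglyMeasurable (by fun_prop))

theorem locallyIntegrable_newtonPotential (hi : Integrable ρ) (hs : SphericallySymmetric ρ)
    (h0 : ∀ᵐ x, 0 ≤ ρ x) : LocallyIntegrable (newtonPotential ρ) volume := by
  refine (LocallyIntegrable.smul (locallyIntegrable_rpow_norm (show (-3 : ℝ) < -1 by norm_num))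
    (∫ x, ρ x)).mono ?_ ?_
  · have := (aestronglyMeasurable_mul_inv_max_norm hi).integral_prod_right'.neg
    exact this.congr (Eventually.of_forall fun x => (newtonPotential_eq hi hs h0 x).symm)
  · have hae : ∀ᵐ x : E3, x ≠ 0 := compl_mem_ae_iff.2 (measure_singleton 0)
    filter_upwards [hae] with x hx
    rw [newtonPotential_eq hi hs h0, norm_neg, Real.norm_of_nonneg (integral_nonneg_of_ae
      (h0.mono fun y hy => mul_nonneg hy (by positivity)))]
    refine le_trans ?_ (Real.le_norm_self _)
    rw [Pi.smul_apply, smul_eq_mul, Real.rpow_neg_one, ← integral_mul_const]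
    refine integral_mono_of_nonneg (h0.mono fun y hy => mul_nonneg hy (by positivity))
      (hi.mul_const _) (h0.mono fun y hy => ?_)
    exact mul_le_mul_of_nonneg_left (inv_max_norm_le hx) hy

/-- The potential is a superposition of shell potentials. Fubini moves the derivative onto each
shell, and the density integrated over the shells with `‖y‖ < ‖x‖` is the enclosed mass. -/
theorem isWeakGradient_newtonPotential (hi : Integrable ρ) (hs : SphericallySymmetric ρ)
    (h0 : ∀ᵐ x, 0 ≤ ρ x) : IsWeakGradient (newtonPotential ρ) (radialField (massIn ρ)) := by
  refine ⟨locallyIntegrable_newtonPotential hi hs h0, locallyIntegrable_radialField hi h0, ?_⟩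
  intro φ hφ hc v
  have hae : ∀ᵐ x : E3, x ≠ 0 := compl_mem_ae_iff.2 (measure_singleton 0)
  have hdφ : Continuous fun x => fderiv ℝ φ x v :=
    (hφ.continuous_fderiv (by simp)).clm_apply continuous_const
  have hdc : HasCompactSupport fun x => fderiv ℝ φ x v := hc.fderiv_apply ℝ v
  -- Majorants for the two applications of Fubini: `‖x‖⁻¹` for the potential and `‖x‖⁻²` for the
  -- field are locally integrable, and the test function has compact support.
  have hb1 : Integrable fun x : E3 => ‖x‖⁻¹ * ‖fderiv ℝ φ x v‖ := by
    have := (locallyIntegrable_rpow_norm (show (-3 : ℝ) < -1 by norm_num)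
      ).integrable_smul_right_of_hasCompactSupport hdφ.norm hdc.norm
    simpa [Real.rpow_neg_one] using this
  have hb2 : Integrable fun x : E3 => ‖x‖ ^ (-2 : ℝ) * (‖v‖ * ‖φ x‖) := by
    have := (locallyIntegrable_rpow_norm (show (-3 : ℝ) < -2 by norm_num)
      ).integrable_smul_right_of_hasCompactSupport (hφ.continuous.norm.const_smul ‖v‖)
        (hc.norm.smul_left (f := fun _ => ‖v‖))
    simpa using this
  have hI1 : Integrable (Function.uncurry fun (x y : E3) =>
      ρ y * (max ‖x‖ ‖y‖)⁻¹ * fderiv ℝ φ x v) (volume.prod volume) := by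
    refine (hb1.mul_prod hi.norm).mono' ((aestronglyMeasurable_mul_inv_max_norm hi).mul
      hdφ.aestronglyMeasurable.comp_fst) ?_
    have : ∀ᵐ p : E3 × E3 ∂(volume.prod volume), p.1 ≠ 0 :=
      Measure.quasiMeasurePreserving_fst.ae hae
    filter_upwards [this] with p hp
    simp only [Function.uncurry, norm_mul]
    have h1 := inv_max_norm_le (y := p.2) hp
    rw [Real.norm_of_nonneg (show 0 ≤ (max ‖p.1‖ ‖p.2‖)⁻¹ by positivity)]
    calc ‖ρ p.2‖ * (max ‖p.1‖ ‖p.2‖)⁻¹ * ‖fderiv ℝ φ p.1 v‖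
        ≤ ‖ρ p.2‖ * ‖p.1‖⁻¹ * ‖fderiv ℝ φ p.1 v‖ := by gcongr
      _ = _ := by ring
  have hI2 : Integrable (Function.uncurry fun (x y : E3) =>
      ρ y * ({x : E3 | ‖y‖ < ‖x‖}.indicator (fun x => inner ℝ x v / ‖x‖ ^ 3) x * φ x))
      (volume.prod volume) := by
    refine (hb2.mul_prod hi.norm).mono' (hi.aestronglyMeasurable.comp_snd.mul
      (AEStronglyMeasurable.mul ?_ hφ.continuous.aestronglyMeasurable.comp_fst)) ?_
    · have : Measurable ({p : E3 × E3 | ‖p.2‖ < ‖p.1‖}.indicator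
          fun p => inner ℝ p.1 v / ‖p.1‖ ^ 3) :=
        Measurable.indicator (by fun_prop) (measurableSet_lt (by fun_prop) (by fun_prop))
      exact this.aestronglyMeasurable
    · refine Eventually.of_forall fun p => ?_
      simp only [Function.uncurry, norm_mul]
      have h1 : ‖{x : E3 | ‖p.2‖ < ‖x‖}.indicator (fun x => inner ℝ x v / ‖x‖ ^ 3) p.1‖ ≤
          ‖p.1‖ ^ (-2 : ℝ) * ‖v‖ := by
        refine (norm_indicator_le_norm_self _ _).trans ?_
        rw [Real.rpow_neg (norm_nonneg _), norm_div]
        norm_cast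
        rcases eq_or_ne p.1 0 with hp | hp
        · simp [hp]
        have hp' := norm_pos_iff.2 hp
        rw [Real.norm_of_nonneg (show 0 ≤ ‖p.1‖ ^ 3 by positivity), div_le_iff₀ (by positivity)]
        calc ‖inner ℝ p.1 v‖ ≤ ‖p.1‖ * ‖v‖ := norm_inner_le_norm _ _
          _ = _ := by field_simp
      calc _ ≤ ‖ρ p.2‖ * (‖p.1‖ ^ (-2 : ℝ) * ‖v‖ * ‖φ p.1‖) := by gcongr
        _ = _ := by ring
  calc ∫ x, newtonPotential ρ x * fderiv ℝ φ x v
      = -∫ x, ∫ y, ρ y * (max ‖x‖ ‖y‖)⁻¹ * fderiv ℝ φ x v := by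
        rw [← integral_neg]
        refine integral_congr_ae (Eventually.of_forall fun x => ?_)
        simp only
        rw [newtonPotential_eq hi hs h0, integral_mul_const]
        ring
    _ = -∫ y, ∫ x, ρ y * (max ‖x‖ ‖y‖)⁻¹ * fderiv ℝ φ x v := by
        rw [integral_integral_swap hI1]
    _ = -∫ y, ∫ x, ρ y *
        ({x : E3 | ‖y‖ < ‖x‖}.indicator (fun x => inner ℝ x v / ‖x‖ ^ 3) x * φ x) := by
        congr 1
        refine integral_congr_ae (hae.mono fun y hy => ?_)
        simp only [mul_assoc]
        rw [integral_const_mul, integral_const_mul,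
          integral_inv_max_norm_mul_fderiv (norm_pos_iff.2 hy) hφ hc]
    _ = -∫ x, ∫ y, ρ y *
        ({x : E3 | ‖y‖ < ‖x‖}.indicator (fun x => inner ℝ x v / ‖x‖ ^ 3) x * φ x) := by
        rw [integral_integral_swap hI2]
    _ = -∫ x, inner ℝ (radialField (massIn ρ) x) v * φ x := by
        congr 1
        refine integral_congr_ae (Eventually.of_forall fun x => ?_)
        simp only [radialField, massIn, real_inner_smul_left]
        rw [← integral_indicator Metric.isOpen_ball.measurableSet, ← integral_div,
          ← integral_mul_const, ← integral_mul_const]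
        refine integral_congr_ae (Eventually.of_forall fun y => ?_)
        by_cases h : ‖y‖ < ‖x‖
        · simp [indicator, h]; ring
        · simp [indicator, h]

end

/-- Weak gradients are unique up to null sets. -/
theorem IsWeakGradient.ae_eq {u : E3 → ℝ} {F G : E3 → E3} (hF : IsWeakGradient u F)
    (hG : IsWeakGradient u G) : F =ᵐ[volume] G := by
  have hl := hF.locallyIntegrable_grad.sub hG.locallyIntegrable_grad
  have key : ∀ᵐ x, (F - G) x = 0 := by
    refine ae_eq_zero_of_integral_contDiff_smul_eq_zero hl fun φ hφ hc => ?_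
    have hi : ∀ H : E3 → E3, LocallyIntegrable H volume → Integrable fun x => φ x • H x :=
      fun H hH => hH.integrable_smul_left_of_hasCompactSupport hφ.continuous hc
    refine ext_inner_right ℝ fun v => ?_
    rw [inner_zero_left, real_inner_comm, ← integral_inner (hi _ hl)]
    have h1 := hF.integral_eq φ hφ hc v
    rw [hG.integral_eq φ hφ hc v, neg_inj] at h1
    have hii : ∀ H : E3 → E3, LocallyIntegrable H volume →
        Integrable fun x => inner ℝ (H x) v * φ x := fun H hH => by
      refine ((hi H hH).const_inner v).congr (Eventually.of_forall fun x => ?_)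
      simp only [real_inner_smul_right, real_inner_comm]
      ring
    have h2 : ∀ x, inner ℝ v (φ x • (F - G) x) = inner ℝ (F x) v * φ x - inner ℝ (G x) v * φ x := by
      intro x
      rw [real_inner_smul_right, Pi.sub_apply, inner_sub_right, real_inner_comm, real_inner_comm v (G x)]
      ring
    simp_rw [h2]
    rw [integral_sub (hii _ hF.locallyIntegrable_grad) (hii _ hG.locallyIntegrable_grad), h1,
      sub_self]
  filter_upwards [key] with x hx
  exact sub_eq_zero.1 hx

/-- `gradNewton` is a choice among a.e. equal weak gradients; this replaces it by the explicit
radial field. -/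
theorem gradNewton_ae_eq {ρ : E3 → ℝ} (hi : Integrable ρ) (hs : SphericallySymmetric ρ)
    (h0 : ∀ᵐ x, 0 ≤ ρ x) : gradNewton ρ =ᵐ[volume] radialField (massIn ρ) := by
  have h := isWeakGradient_newtonPotential hi hs h0
  have hex : ∃ F, IsWeakGradient (newtonPotential ρ) F := ⟨_, h⟩
  have : gradNewton ρ = hex.choose := by rw [gradNewton, weakGradient, dif_pos hex]
  rw [this]
  exact hex.choose_spec.ae_eq h

/-! ### Dominated convergence and weak compactness in `L^p` -/

section Lp

variable {α : Type*} [MeasurableSpace α] {μ : Measure α}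

/-- Dominated convergence in `L^p`. -/
theorem tendsto_eLpNorm_sub_of_dominated {V ι : Type*} [NormedAddCommGroup V] {l : Filter ι}
    [l.IsCountablyGenerated] {p : ℝ≥0∞} (hp0 : p ≠ 0) (hp : p ≠ ⊤) {F : ι → α → V} {f : α → V}
    {b : α → ℝ} (hF : ∀ i, AEStronglyMeasurable (F i) μ) (hf : AEStronglyMeasurable f μ)
    (hb : MemLp b p μ) (hFb : ∀ i, ∀ᵐ x ∂μ, ‖F i x‖ ≤ b x) (hfb : ∀ᵐ x ∂μ, ‖f x‖ ≤ b x)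
    (hlim : ∀ᵐ x ∂μ, Tendsto (fun i => F i x) l (𝓝 (f x))) :
    Tendsto (fun i => eLpNorm (fun x => F i x - f x) p μ) l (𝓝 0) := by
  have hpr := ENNReal.toReal_pos hp0 hp
  simp_rw [eLpNorm_eq_lintegral_rpow_enorm_toReal hp0 hp]
  have h1 : Tendsto (fun i => ∫⁻ x, ‖F i x - f x‖ₑ ^ p.toReal ∂μ) l (𝓝 (∫⁻ _, 0 ∂μ)) := by
    refine tendsto_lintegral_filter_of_dominated_convergence'
      (fun x => (2 * ‖b x‖ₑ) ^ p.toReal) (Eventually.of_forall fun i => ?_)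
      (Eventually.of_forall fun i => ?_) ?_ ?_
    · exact ((hF i).sub hf).enorm.pow_const _
    · filter_upwards [hFb i, hfb] with x h1 h2
      have hb1 : ∀ z : V, ‖z‖ ≤ b x → ‖z‖ₑ ≤ ‖b x‖ₑ := fun z hz =>
        enorm_le_iff_norm_le.2 (hz.trans (Real.le_norm_self _))
      gcongr
      calc ‖F i x - f x‖ₑ ≤ ‖F i x‖ₑ + ‖f x‖ₑ := enorm_sub_le
        _ ≤ ‖b x‖ₑ + ‖b x‖ₑ := add_le_add (hb1 _ h1) (hb1 _ h2)
        _ = _ := (two_mul _).symm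
    · simp_rw [ENNReal.mul_rpow_of_nonneg _ _ hpr.le]
      rw [lintegral_const_mul' _ _ (ENNReal.rpow_ne_top_of_nonneg hpr.le (by simp))]
      exact ENNReal.mul_ne_top (ENNReal.rpow_ne_top_of_nonneg hpr.le (by simp))
        (lintegral_rpow_enorm_lt_top_of_eLpNorm_lt_top hp0 hp hb.2).ne
    · filter_upwards [hlim] with x hx
      have h2 : Tendsto (fun i => ‖F i x - f x‖ₑ) l (𝓝 0) := by
        have h3 := (tendsto_sub_nhds_zero_iff.2 hx).enorm
        rwa [enorm_zero] at h3
      simpa [ENNReal.zero_rpow_of_pos hpr] using (h2.ennrpow_const p.toReal)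
  rw [lintegral_zero] at h1
  have h2 := h1.ennrpow_const (1 / p.toReal)
  rwa [ENNReal.zero_rpow_of_pos (by positivity)] at h2

theorem toLp_eq_zero_of_ae {p : ℝ≥0∞} {f : α → ℝ} (hf : MemLp f p μ) (h : ∀ᵐ x ∂μ, f x = 0) :
    hf.toLp f = 0 :=
  Lp.ext ((hf.coeFn_toLp.trans h).trans (Lp.coeFn_zero ℝ p μ).symm)

variable {q : ℝ≥0∞} [Fact (1 ≤ q)]

theorem tendsto_toLp_of_dominated {ι : Type*} {l : Filter ι}
    [l.IsCountablyGenerated] (hq : q ≠ ⊤) {F : ι → α → ℝ} {f b : α → ℝ}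
    (hF : ∀ i, MemLp (F i) q μ) (hf : MemLp f q μ)
    (hb : MemLp b q μ) (hFb : ∀ i, ∀ᵐ x ∂μ, ‖F i x‖ ≤ b x) (hfb : ∀ᵐ x ∂μ, ‖f x‖ ≤ b x)
    (hlim : ∀ᵐ x ∂μ, Tendsto (fun i => F i x) l (𝓝 (f x))) :
    Tendsto (fun i => (hF i).toLp (F i)) l (𝓝 (hf.toLp f)) := by
  rw [Lp.tendsto_Lp_iff_tendsto_eLpNorm'']
  exact tendsto_eLpNorm_sub_of_dominated
    (zero_lt_one.trans_le (Fact.out : 1 ≤ q)).ne' hq (fun i => (hF i).1) hf.1 hb hFb hfb hlim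

/-- The finite measure `S ↦ L (1_S w)` defined by a positive functional on `L^q` and a weight. -/
theorem exists_measure_of_nonneg_dual (hq : q ≠ ⊤) {w : α → ℝ} (hw0 : ∀ x, 0 < w x)
    (hw : MemLp w q μ) (L : StrongDual ℝ (Lp ℝ q μ))
    (hL : ∀ g (hg : MemLp g q μ), (∀ᵐ x ∂μ, 0 ≤ g x) → 0 ≤ L (hg.toLp g)) :
    ∃ ν : Measure α, IsFiniteMeasure ν ∧ ν ≪ μ ∧
      ∀ S (hS : MeasurableSet S), ν.real S = L ((hw.indicator hS).toLp (S.indicator w)) := by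
  have hpos : ∀ S (hS : MeasurableSet S), 0 ≤ L ((hw.indicator hS).toLp (S.indicator w)) :=
    fun S hS => hL _ _ (Eventually.of_forall fun x => indicator_nonneg (fun x _ => (hw0 x).le) x)
  -- On an infinite measure space `1_S` need not lie in `L^q`; weighting by a positive `w ∈ L^q`
  -- makes the set function finite on every measurable set. Countable additivity is dominated
  -- convergence in `L^q`.
  let ν : Measure α := Measure.ofMeasurable
    (fun S hS => ENNReal.ofReal (L ((hw.indicator hS).toLp (S.indicator w))))
    (by
      have : (hw.indicator MeasurableSet.empty).toLp ((∅ : Set α).indicator w) = 0 :=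
        toLp_eq_zero_of_ae _ (by simp)
      simp only [this, map_zero, ENNReal.ofReal_zero])
    (by
      intro f hf hd
      have hsum : HasSum (fun i => L ((hw.indicator (hf i)).toLp ((f i).indicator w)))
          (L ((hw.indicator (MeasurableSet.iUnion hf)).toLp ((⋃ i, f i).indicator w))) := by
        have hbm : ∀ s : Finset ℕ, MeasurableSet (⋃ i ∈ s, f i) := fun s =>
          s.measurableSet_biUnion fun i _ => hf i
        have h1 : Tendsto (fun s : Finset ℕ => L ((hw.indicator (hbm s)).toLp
            ((⋃ i ∈ s, f i).indicator w))) atTop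
            (𝓝 (L ((hw.indicator (MeasurableSet.iUnion hf)).toLp ((⋃ i, f i).indicator w)))) := by
          refine (L.continuous.tendsto _).comp (tendsto_toLp_of_dominated hq _ _ hw.norm
            (fun s => Eventually.of_forall fun x => norm_indicator_le_norm_self _ _)
            (Eventually.of_forall fun x => norm_indicator_le_norm_self _ _)
            (Eventually.of_forall fun x => ?_))
          exact (tendsto_indicator_biUnion_finset f w x).mono_right (pure_le_nhds _)
        refine h1.congr fun s => ?_
        rw [← map_sum]
        congr 1
        induction s using Finset.induction_on with
        | empty => exact toLp_eq_zero_of_ae _ (by simp)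
        | insert i s his ih =>
          rw [Finset.sum_insert his, ← ih, ← MemLp.toLp_add]
          refine MemLp.toLp_congr _ _ (Eventually.of_forall fun x => ?_)
          rw [Finset.set_biUnion_insert]
          have hdis : Disjoint (f i) (⋃ j ∈ s, f j) := by
            rw [disjoint_iUnion₂_right]
            exact fun j hj => hd (fun h => his (h ▸ hj))
          rw [indicator_union_of_disjoint hdis, Pi.add_apply]
      rw [← hsum.tsum_eq, ENNReal.ofReal_tsum_of_nonneg (fun i => hpos _ (hf i)) hsum.summable])
  have hν : ∀ S (hS : MeasurableSet S),
      ν S = ENNReal.ofReal (L ((hw.indicator hS).toLp (S.indicator w))) := fun S hS =>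
    Measure.ofMeasurable_apply S hS
  refine ⟨ν, ⟨by rw [hν _ MeasurableSet.univ]; exact ENNReal.ofReal_lt_top⟩, ?_, ?_⟩
  · refine Measure.AbsolutelyContinuous.mk fun S hS h0 => ?_
    rw [hν S hS]
    have : (hw.indicator hS).toLp (S.indicator w) = 0 := by
      refine toLp_eq_zero_of_ae _ ?_
      have : ∀ᵐ x ∂μ, x ∉ S := measure_eq_zero_iff_ae_notMem.1 h0
      filter_upwards [this] with x hx
      simp [hx]
    rw [this, map_zero, ENNReal.ofReal_zero]
  · intro S hS
    rw [measureReal_def, hν S hS, ENNReal.toReal_ofReal (hpos S hS)]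

/-- A positive functional on `L^q`, `q < ∞`, is represented by a density. -/
theorem exists_density_of_nonneg_dual [SigmaFinite μ] (hq : q ≠ ⊤) {w : α → ℝ}
    (hw0 : ∀ x, 0 < w x) (hwm : Measurable w) (hw : MemLp w q μ) (L : StrongDual ℝ (Lp ℝ q μ))
    (hL : ∀ g (hg : MemLp g q μ), (∀ᵐ x ∂μ, 0 ≤ g x) → 0 ≤ L (hg.toLp g)) :
    ∃ f : α → ℝ, Measurable f ∧ (∀ x, 0 ≤ f x) ∧ ∀ g (hg : MemLp g q μ),
      Integrable (fun x => f x * g x) μ ∧ L (hg.toLp g) = ∫ x, f x * g x ∂μ := by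
  obtain ⟨ν, hνfin, hac, hν⟩ := exists_measure_of_nonneg_dual hq hw0 hw L hL
  have hmem : ∀ s : SimpleFunc α ℝ, MemLp (fun x => s x * w x) q μ := by
    intro s
    obtain ⟨C, hC⟩ := s.exists_forall_norm_le
    refine (hw.const_mul C).mono (s.measurable.mul hwm).aestronglyMeasurable
      (Eventually.of_forall fun x => ?_)
    rw [norm_mul, norm_mul]
    gcongr
    exact (hC x).trans (Real.le_norm_self _)
  have hsi : ∀ s : SimpleFunc α ℝ, Integrable s ν := fun s =>
    SimpleFunc.integrable_of_isFiniteMeasure s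
  have hsimple : ∀ s : SimpleFunc α ℝ, L ((hmem s).toLp _) = ∫ x, s x ∂ν := by
    intro s
    induction s using SimpleFunc.induction with
    | const c hS =>
      rename_i S
      have h1 : (hmem (SimpleFunc.piecewise S hS (SimpleFunc.const α c)
          (SimpleFunc.const α 0))).toLp _ =
          c • (hw.indicator hS).toLp (S.indicator w) := by
        rw [← MemLp.toLp_const_smul]
        refine MemLp.toLp_congr _ _ (Eventually.of_forall fun x => ?_)
        by_cases hx : x ∈ S <;> simp [hx]
      rw [h1, map_smul, ← hν S hS]
      simp only [SimpleFunc.coe_piecewise, SimpleFunc.coe_const, Function.const_zero,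
        piecewise_eq_indicator]
      rw [integral_indicator hS]
      simp [mul_comm]
    | add hd h1 h2 =>
      rename_i s t
      have h3 : (hmem (s + t)).toLp _ = (hmem s).toLp _ + (hmem t).toLp _ := by
        rw [← MemLp.toLp_add]
        refine MemLp.toLp_congr _ _ (Eventually.of_forall fun x => ?_)
        simp [add_mul]
      rw [h3, map_add, h1, h2, ← integral_add (hsi s) (hsi t)]
      simp
  -- With `g = (g / w) * w`, approximate `g / w` by simple functions, for which the representation
  -- by `ν` is already known.
  have hmain : ∀ g (hg : MemLp g q μ), Measurable g →
      Integrable (fun x => g x / w x) ν ∧ L (hg.toLp g) = ∫ x, g x / w x ∂ν := by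
    intro g hg hgm
    have hm : Measurable fun x => g x / w x := hgm.div hwm
    let s : ℕ → SimpleFunc α ℝ := fun n =>
      SimpleFunc.approxOn (fun x => g x / w x) hm univ 0 (mem_univ 0) n
    have hslim : ∀ x, Tendsto (fun n => s n x) atTop (𝓝 (g x / w x)) := fun x =>
      SimpleFunc.tendsto_approxOn hm (mem_univ 0) (by simp)
    have hsb : ∀ n x, ‖s n x‖ ≤ 2 * ‖g x / w x‖ := fun n x => by
      rw [two_mul]; exact SimpleFunc.norm_approxOn_zero_le hm (mem_univ 0) x n
    have hswb : ∀ n x, ‖s n x * w x‖ ≤ 2 * ‖g x‖ := fun n x => by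
      calc ‖s n x * w x‖ = ‖s n x‖ * w x := by rw [norm_mul, Real.norm_of_nonneg (hw0 x).le]
        _ ≤ 2 * ‖g x / w x‖ * w x := mul_le_mul_of_nonneg_right (hsb n x) (hw0 x).le
        _ = 2 * ‖g x‖ := by
          rw [norm_div, Real.norm_of_nonneg (hw0 x).le, mul_assoc, div_mul_cancel₀ _ (hw0 x).ne']
    have hb : MemLp (fun x => 2 * ‖g x‖) q μ := hg.norm.const_mul 2
    have hL1 : Tendsto (fun n => L ((hmem (s n)).toLp _)) atTop (𝓝 (L (hg.toLp g))) := by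
      refine (L.continuous.tendsto _).comp (tendsto_toLp_of_dominated hq _ _ hb
        (fun n => Eventually.of_forall fun x => hswb n x)
        (Eventually.of_forall fun x => by linarith [norm_nonneg (g x)])
        (Eventually.of_forall fun x => ?_))
      have := (hslim x).mul_const (w x)
      rwa [div_mul_cancel₀ _ (hw0 x).ne'] at this
    -- Applying `L` to `|s n| * w` bounds the `L¹(ν)` norms uniformly, so Fatou gives integrability
    -- of `g / w`.
    have hnorm : ∀ n, ∫ x, ‖s n x‖ ∂ν ≤ ‖L‖ * ‖hb.toLp _‖ := by
      intro n
      have h1 : ∫ x, ‖s n x‖ ∂ν = ∫ x, (s n).map norm x ∂ν := rfl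
      rw [h1, ← hsimple]
      refine (Real.le_norm_self _).trans ((L.le_opNorm _).trans ?_)
      gcongr
      refine Lp.norm_le_norm_of_ae_le ?_
      filter_upwards [MemLp.coeFn_toLp (hmem ((s n).map norm)), MemLp.coeFn_toLp hb] with x h2 h3
      rw [h2, h3]
      have := hswb n x
      rw [norm_mul] at this
      simp only [SimpleFunc.map_apply, norm_mul, norm_norm]
      simpa using this
    have hint : Integrable (fun x => g x / w x) ν := by
      refine ⟨hm.aestronglyMeasurable, ?_⟩
      have h1 : ∫⁻ x, ‖g x / w x‖ₑ ∂ν ≤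
          liminf (fun n => ∫⁻ x, ‖s n x‖ₑ ∂ν) atTop := by
        have h2 : ∀ x, ‖g x / w x‖ₑ = liminf (fun n => ‖s n x‖ₑ) atTop := fun x =>
          ((hslim x).enorm.liminf_eq).symm
        simp_rw [h2]
        exact lintegral_liminf_le fun n => (s n).measurable.enorm
      have h3 : ∀ n, ∫⁻ x, ‖s n x‖ₑ ∂ν ≤ ENNReal.ofReal (‖L‖ * ‖hb.toLp _‖) := by
        intro n
        rw [← ofReal_integral_norm_eq_lintegral_enorm (hsi _)]
        exact ENNReal.ofReal_le_ofReal (hnorm n)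
      exact (h1.trans (liminf_le_of_frequently_le'
        (Eventually.of_forall h3).frequently)).trans_lt ENNReal.ofReal_lt_top
    refine ⟨hint, tendsto_nhds_unique hL1 ?_⟩
    simp_rw [hsimple]
    exact tendsto_integral_of_dominated_convergence (fun x => 2 * ‖g x / w x‖)
      (fun n => (s n).measurable.aestronglyMeasurable) (hint.norm.const_mul 2)
      (fun n => Eventually.of_forall fun x => hsb n x) (Eventually.of_forall hslim)
  -- Dividing the Radon–Nikodym density by `w` undoes the weight.
  refine ⟨fun x => (ν.rnDeriv μ x).toReal / w x, (Measure.measurable_rnDeriv _ _).ennreal_toReal.div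
    hwm, fun x => div_nonneg ENNReal.toReal_nonneg (hw0 x).le, fun g hg => ?_⟩
  obtain ⟨g', hg'm, hgg'⟩ := hg.1.aemeasurable
  have hg' : MemLp g' q μ := (memLp_congr_ae hgg').1 hg
  obtain ⟨h1, h2⟩ := hmain g' hg' hg'm
  have hae : (fun x => (ν.rnDeriv μ x).toReal / w x * g x) =ᵐ[μ]
      fun x => (ν.rnDeriv μ x).toReal • (g' x / w x) := by
    filter_upwards [hgg'] with x hx
    rw [hx, smul_eq_mul]; ring
  refine ⟨((integrable_rnDeriv_smul_iff hac).2 h1).congr hae.symm, ?_⟩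
  rw [integral_congr_ae hae, integral_rnDeriv_smul hac, ← h2, MemLp.toLp_congr hg hg' hgg']

/-- Bounded sequences of nonnegative functions in `L^p`, `p > 1`, have subsequences that converge
weakly to a nonnegative function. -/
theorem exists_weak_limit_of_nonneg [SigmaFinite μ] [IsSeparable μ] {p : ℝ≥0∞} [Fact (1 ≤ p)]
    [ENNReal.HolderConjugate p q]
    (hq : q ≠ ⊤) {w : α → ℝ} (hw0 : ∀ x, 0 < w x) (hwm : Measurable w) (hw : MemLp w q μ)
    {f : ℕ → α → ℝ} (hf : ∀ j, MemLp (f j) p μ) (hf0 : ∀ j, ∀ᵐ x ∂μ, 0 ≤ f j x) {K : ℝ}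
    (hK : ∀ j, ‖(hf j).toLp (f j)‖ ≤ K) :
    ∃ k : ℕ → ℕ, StrictMono k ∧ ∃ f₀ : α → ℝ, Measurable f₀ ∧ (∀ x, 0 ≤ f₀ x) ∧
      ∀ g, MemLp g q μ → Integrable (fun x => f₀ x * g x) μ ∧
        Tendsto (fun j => ∫ x, f (k j) x * g x ∂μ) atTop (𝓝 (∫ x, f₀ x * g x ∂μ)) := by
  have : Fact (q ≠ ⊤) := ⟨hq⟩
  let T : Lp ℝ p μ →L[ℝ] StrongDual ℝ (Lp ℝ q μ) :=
    ContinuousLinearMap.lpPairing μ p q (ContinuousLinearMap.mul ℝ ℝ)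
  let φ : ℕ → WeakDual ℝ (Lp ℝ q μ) := fun j =>
    StrongDual.toWeakDual (T ((hf j).toLp (f j)))
  have hφ : ∀ j g (hg : MemLp g q μ), φ j (hg.toLp g) = ∫ x, f j x * g x ∂μ := by
    intro j g hg
    change T ((hf j).toLp (f j)) (hg.toLp g) = _
    rw [ContinuousLinearMap.lpPairing_eq_integral]
    refine integral_congr_ae ?_
    filter_upwards [(hf j).coeFn_toLp, hg.coeFn_toLp] with x h1 h2
    simp [h1, h2]
  have hmem : ∀ j, φ j ∈ WeakDual.toStrongDual ⁻¹'
      Metric.closedBall (0 : StrongDual ℝ (Lp ℝ q μ)) (‖T‖ * K) := by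
    intro j
    rw [mem_preimage, mem_closedBall_zero_iff]
    exact (T.le_opNorm _).trans (mul_le_mul_of_nonneg_left (hK j) (norm_nonneg _))
  -- Sequential Banach–Alaoglu in the dual of the separable space `L^q`. The limit functional is
  -- positive because the functions are nonnegative, hence it is given by a density.
  obtain ⟨L, -, k, hk, hkL⟩ := WeakDual.isSeqCompact_closedBall ℝ (Lp ℝ q μ) 0 (‖T‖ * K) hmem
  have hlim : ∀ g (hg : MemLp g q μ),
      Tendsto (fun j => ∫ x, f (k j) x * g x ∂μ) atTop (𝓝 (L (hg.toLp g))) := by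
    intro g hg
    have h1 := ((WeakDual.eval_continuous (hg.toLp g)).tendsto L).comp hkL
    refine h1.congr fun j => ?_
    exact hφ (k j) g hg
  obtain ⟨f₀, hm, h0, hr⟩ := exists_density_of_nonneg_dual hq hw0 hwm hw
    (WeakDual.toStrongDual L) (fun g hg hg0 => by
      refine ge_of_tendsto' (hlim g hg) fun j => integral_nonneg_of_ae ?_
      filter_upwards [hg0, hf0 (k j)] with x h1 h2 using mul_nonneg h2 h1)
  refine ⟨k, hk, f₀, hm, h0, fun g hg => ⟨(hr g hg).1, ?_⟩⟩
  rw [← (hr g hg).2]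
  exact hlim g hg

end Lp

/-! ### Convexity and growth of `Ψ` -/

section Psi

variable {n : ℝ} {Ψ : ℝ → ℝ}

/-- A convex function lies above its tangents. At `s = 0` this gives `Ψ ≥ 0`; at `s = ρ₀ x` it gives
weak lower semicontinuity of the Casimir functional. -/
theorem PsiAssumptions.tangent_le (hΨ : PsiAssumptions n Ψ) {s t : ℝ} (hs : 0 ≤ s) (ht : 0 ≤ t) :
    Ψ s + derivWithin Ψ (Ici 0) s * (t - s) ≤ Ψ t := by
  have hd := hΨ.contDiffOn.differentiableOn one_ne_zero s hs
  rcases lt_trichotomy s t with h | rfl | h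
  · have := hΨ.strictConvexOn.convexOn.derivWithin_le_slope hs ht h hd
    rw [slope_def_field, le_div_iff₀ (sub_pos.2 h)] at this
    linarith
  · simp
  · have := hΨ.strictConvexOn.convexOn.slope_le_derivWithin ht hs h hd
    rw [slope_def_field, div_le_iff₀ (sub_pos.2 h)] at this
    linarith

theorem PsiAssumptions.nonneg (hΨ : PsiAssumptions n Ψ) {t : ℝ} (ht : 0 ≤ t) : 0 ≤ Ψ t := by
  simpa [hΨ.zero, hΨ.deriv_zero] using hΨ.tangent_le le_rfl ht

theorem PsiAssumptions.continuous_comp_max (hΨ : PsiAssumptions n Ψ) :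
    Continuous fun s => Ψ (max s 0) :=
  hΨ.contDiffOn.continuousOn.comp_continuous (by fun_prop) fun s => mem_Ici.2 (le_max_right s 0)

theorem PsiAssumptions.continuous_deriv_comp_max (hΨ : PsiAssumptions n Ψ) :
    Continuous fun s => derivWithin Ψ (Ici 0) (max s 0) :=
  (hΨ.contDiffOn.continuousOn_derivWithin (uniqueDiffOn_Ici 0) le_rfl).comp_continuous
    (by fun_prop) fun s => mem_Ici.2 (le_max_right s 0)

/-- The growth condition controls the `L^(1+1/n)` norm. -/
theorem PsiAssumptions.exists_rpow_le (hn : 0 < n) (hΨ : PsiAssumptions n Ψ) :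
    ∃ a b : ℝ, 0 < a ∧ 0 < b ∧ ∀ s, 0 ≤ s → s ^ (1 + 1 / n) ≤ a * s + b * Ψ s := by
  obtain ⟨C, hC, hev⟩ := hΨ.lower
  obtain ⟨s₀, hs₀⟩ := eventually_atTop.1 hev
  -- Beyond the threshold the growth of `Ψ` applies; below it, `s ^ (1 + 1 / n)` is at most the
  -- threshold to the power `1 / n`, times `s`.
  have h1 : 0 < max s₀ 1 := lt_max_of_lt_right one_pos
  refine ⟨max s₀ 1 ^ (1 / n), C⁻¹, by positivity, by positivity, fun s hs => ?_⟩
  have hΨs := hΨ.nonneg hs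
  rcases le_total (max s₀ 1) s with h | h
  · have h2 := hs₀ s ((le_max_left _ _).trans h)
    have h3 : s ^ (1 + 1 / n) ≤ C⁻¹ * Ψ s := by
      rw [inv_mul_eq_div, le_div_iff₀ hC]; linarith
    have : 0 ≤ max s₀ 1 ^ (1 / n) * s := by positivity
    linarith
  · rcases hs.eq_or_lt with rfl | hs'
    · rw [Real.zero_rpow (by positivity), hΨ.zero]; simp
    · have h4 : s ^ (1 / n) ≤ max s₀ 1 ^ (1 / n) := Real.rpow_le_rpow hs h (by positivity)
      rw [Real.rpow_add hs', Real.rpow_one, mul_comm]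
      have : 0 ≤ C⁻¹ * Ψ s := by positivity
      nlinarith

end Psi

/-! ### Monotonicity and growth of `Q` -/

section MondQ

variable {lam : ℝ → ℝ}

theorem LambdaAssumptions.exists_mul_le (hlam : LambdaAssumptions lam) :
    ∃ Λ : ℝ, 0 < Λ ∧ ∀ w, 0 ≤ w → lam w * w ≤ Λ * √w := by
  obtain ⟨Λ, hΛ, h⟩ := hlam.upper
  refine ⟨Λ, hΛ, fun w hw => ?_⟩
  rcases hw.eq_or_lt with rfl | hw'
  · simp
  · calc lam w * w ≤ Λ / √w * w := mul_le_mul_of_nonneg_right (h w hw') hw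
      _ = Λ * √w := by
        have : √w ≠ 0 := by positivity
        rw [div_mul_eq_mul_div, div_eq_iff this, mul_assoc, Real.mul_self_sqrt hw]

/-- Measurability of `lam` is assumed only on `[0, ∞)`, so the integrand is cut off there to obtain
a function measurable on the whole line. -/
theorem LambdaAssumptions.intervalIntegrable_indicator (hlam : LambdaAssumptions lam) (a b : ℝ) :
    IntervalIntegrable ((Ici (0 : ℝ)).indicator fun w => lam w * w) volume a b := by
  obtain ⟨Λ, hΛ, h⟩ := hlam.exists_mul_le
  have hm : AEStronglyMeasurable ((Ici (0 : ℝ)).indicator fun w => lam w * w) volume := by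
    rw [aestronglyMeasurable_indicator_iff measurableSet_Ici]
    exact ((aemeasurable_restrict_of_measurable_subtype measurableSet_Ici
      hlam.measurable).mul aemeasurable_id).aestronglyMeasurable
  have hc : Continuous fun w : ℝ => Λ * √|w| := by fun_prop
  refine (hc.intervalIntegrable a b).mono_fun' hm.restrict (ae_of_all _ fun w => ?_)
  by_cases hw : w ∈ Ici (0 : ℝ)
  · have hw' : 0 ≤ w := hw
    simp only [indicator_of_mem hw]
    rw [Real.norm_of_nonneg (mul_nonneg (hlam.nonneg w hw) hw), abs_of_nonneg hw']
    exact h w hw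
  · simp only [indicator_of_notMem hw, norm_zero]
    positivity

theorem mondQ_eq_indicator {v : ℝ} (hv : 0 ≤ v) :
    mondQ lam v = ∫ w in (0 : ℝ)..v, (Ici (0 : ℝ)).indicator (fun w => lam w * w) w := by
  refine intervalIntegral.integral_congr fun w hw => ?_
  rw [uIcc_of_le hv] at hw
  rw [indicator_of_mem (show w ∈ Ici (0 : ℝ) from hw.1)]

theorem mondQ_sub (hlam : LambdaAssumptions lam) {u v : ℝ} (hu : 0 ≤ u) (huv : u ≤ v) :
    mondQ lam v - mondQ lam u =
      ∫ w in u..v, (Ici (0 : ℝ)).indicator (fun w => lam w * w) w := by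
  rw [mondQ_eq_indicator hu, mondQ_eq_indicator (hu.trans huv),
    intervalIntegral.integral_interval_sub_left (hlam.intervalIntegrable_indicator _ _)
      (hlam.intervalIntegrable_indicator _ _)]

theorem mondQ_mono (hlam : LambdaAssumptions lam) {u v : ℝ} (hu : 0 ≤ u) (huv : u ≤ v) :
    mondQ lam u ≤ mondQ lam v := by
  have h := mondQ_sub hlam hu huv
  have : 0 ≤ ∫ w in u..v, (Ici (0 : ℝ)).indicator (fun w => lam w * w) w :=
    intervalIntegral.integral_nonneg_of_forall huv fun w =>
      indicator_nonneg (fun w hw => mul_nonneg (hlam.nonneg w hw) hw) w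
  linarith

theorem mondQ_zero : mondQ lam 0 = 0 := by simp [mondQ]

theorem mondQ_nonneg (hlam : LambdaAssumptions lam) {v : ℝ} (hv : 0 ≤ v) : 0 ≤ mondQ lam v := by
  simpa [mondQ_zero] using mondQ_mono hlam le_rfl hv

/-- The natural bound is `Λ v ^ (3/2)`; it is weakened to a constant plus a square because on balls
both terms are integrable for `L²` fields. -/
theorem mondQ_le (hlam : LambdaAssumptions lam) :
    ∃ Λ : ℝ, 0 < Λ ∧ ∀ v, 0 ≤ v → mondQ lam v ≤ Λ * (1 + v ^ 2) := by
  obtain ⟨Λ, hΛ, h⟩ := hlam.exists_mul_le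
  refine ⟨Λ, hΛ, fun v hv => ?_⟩
  rw [mondQ_eq_indicator hv]
  have h1 : ∫ w in (0 : ℝ)..v, (Ici (0 : ℝ)).indicator (fun w => lam w * w) w ≤
      ∫ _ in (0 : ℝ)..v, Λ * √v := by
    refine intervalIntegral.integral_mono_on hv (hlam.intervalIntegrable_indicator _ _) (by simp)
      fun w hw => ?_
    rw [indicator_of_mem (show w ∈ Ici (0 : ℝ) from hw.1)]
    refine (h w hw.1).trans ?_
    gcongr
    exact hw.2
  rw [intervalIntegral.integral_const, smul_eq_mul, sub_zero] at h1
  refine h1.trans ?_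
  have h2 : v * √v ≤ 1 + v ^ 2 := by
    nlinarith [Real.sq_sqrt hv, Real.sqrt_nonneg v, sq_nonneg (v - √v), sq_nonneg (√v - 1)]
  nlinarith

theorem continuous_mondQ_abs (hlam : LambdaAssumptions lam) :
    Continuous fun v => mondQ lam |v| := by
  have h := intervalIntegral.continuous_primitive hlam.intervalIntegrable_indicator 0
  have : (fun v => mondQ lam |v|) =
      (fun v => ∫ w in (0 : ℝ)..v, (Ici (0 : ℝ)).indicator (fun w => lam w * w) w) ∘ abs := by
    ext v
    exact mondQ_eq_indicator (abs_nonneg v)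
  rw [this]
  exact h.comp continuous_abs

/-- In the deep MOND regime `Q` grows at least like the power `3 / 2`. -/
theorem exists_le_mondQ_sub (hlam : LambdaAssumptions lam) :
    ∃ c σ₀ : ℝ, 0 < c ∧ 0 < σ₀ ∧ ∀ u v, 0 ≤ u → u ≤ v → v ≤ σ₀ →
      c * ((v - u) * √(v - u)) ≤ mondQ lam v - mondQ lam u := by
  obtain ⟨Λ, hΛ, hev⟩ := hlam.lower
  obtain ⟨ε, hε, hσ⟩ := mem_nhdsGT_iff_exists_Ioc_subset.1 hev
  have hε0 : (0 : ℝ) < ε := hε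
  refine ⟨Λ * (1 / 2 * √(1 / 2)), ε, by positivity, hε0, fun u v hu huv hv => ?_⟩
  -- Only the upper half of the interval is kept: there `w ≥ (v - u) / 2`, so the integrand is at
  -- least `Λ * √((v - u) / 2)`.
  set z := (u + v) / 2 with hz
  have huz : u ≤ z := by linarith
  have hzv : z ≤ v := by linarith
  have h1 := mondQ_mono hlam hu huz
  have h2 := mondQ_sub hlam (hu.trans huz) hzv
  have h3 : ∫ _ in z..v, Λ * √((v - u) / 2) ≤
      ∫ w in z..v, (Ici (0 : ℝ)).indicator (fun w => lam w * w) w := by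
    refine intervalIntegral.integral_mono_on hzv (by simp)
      (hlam.intervalIntegrable_indicator _ _) fun w hw => ?_
    have hw0 : 0 ≤ w := (hu.trans huz).trans hw.1
    rw [indicator_of_mem (show w ∈ Ici (0 : ℝ) from hw0)]
    rcases hw0.eq_or_lt with h0 | h0
    · have : (v - u) / 2 ≤ 0 := by linarith [hw.1]
      rw [Real.sqrt_eq_zero_of_nonpos this, ← h0]
      simp
    · have h4 : Λ / √w ≤ lam w := hσ ⟨h0, hw.2.trans hv⟩
      calc Λ * √((v - u) / 2) ≤ Λ * √w := by
            gcongr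
            linarith [hw.1]
        _ = Λ / √w * w := by
            have : √w ≠ 0 := by positivity
            rw [div_mul_eq_mul_div, eq_div_iff this, mul_assoc, Real.mul_self_sqrt hw0]
        _ ≤ lam w * w := mul_le_mul_of_nonneg_right h4 hw0
  rw [intervalIntegral.integral_const, smul_eq_mul, ← h2] at h3
  have h5 : √((v - u) / 2) = √(1 / 2) * √(v - u) := by
    rw [← Real.sqrt_mul (by norm_num)]
    congr 1
    ring
  rw [h5] at h3
  have h6 : v - z = 1 / 2 * (v - u) := by rw [hz]; ring
  rw [h6] at h3
  calc _ = 1 / 2 * (v - u) * (Λ * (√(1 / 2) * √(v - u))) := by ring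
    _ ≤ _ := by linarith

end MondQ

/-! ### Majorants and energy bounds for radial fields -/

/-- Nonnegative spherically symmetric densities of mass `M` in `L^(1+1/n)`. -/
structure IsLpDensity (n M : ℝ) (ρ : E3 → ℝ) : Prop where
  integrable : Integrable ρ
  symmetric : SphericallySymmetric ρ
  nonneg : ∀ᵐ x, 0 ≤ ρ x
  mass : ∫ x, ρ x = M
  memLp : MemLp ρ (ENNReal.ofReal (1 + 1 / n))

theorem holderConjugate_polytropic {n : ℝ} (hn : 0 < n) : (1 + 1 / n).HolderConjugate (n + 1) := by
  rw [Real.holderConjugate_iff]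
  refine ⟨by simp [hn], ?_⟩
  field_simp

/-- Hölder's inequality for the mass in a ball. -/
theorem massIn_le_rpow {n : ℝ} (hn : 0 < n) {ρ : E3 → ℝ} (h0 : ∀ᵐ x, 0 ≤ ρ x)
    (hp : MemLp ρ (ENNReal.ofReal (1 + 1 / n))) {r : ℝ} (hr : 0 ≤ r) :
    massIn ρ r ≤ (∫ x, ρ x ^ (1 + 1 / n)) ^ (1 / (1 + 1 / n)) *
      (Real.pi * 4 / 3) ^ (1 / (n + 1)) * r ^ (3 / (n + 1)) := by
  have hball := measurableSet_ball (x := (0 : E3)) (ε := r)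
  have hfin : volume (Metric.ball (0 : E3) r) ≠ ⊤ := measure_ball_lt_top.ne
  have h1 := integral_mul_le_Lp_mul_Lq_of_nonneg (μ := volume) (holderConjugate_polytropic hn)
    (f := ρ) (g := (Metric.ball (0 : E3) r).indicator 1) h0
    (Eventually.of_forall fun x => indicator_nonneg (fun _ _ => zero_le_one) x) hp
    (memLp_indicator_const _ hball 1 (Or.inr hfin))
  have h2 : ∫ x, ρ x * (Metric.ball (0 : E3) r).indicator 1 x = massIn ρ r := by
    rw [massIn, ← integral_indicator hball]
    congr 1
    ext x
    by_cases hx : x ∈ Metric.ball (0 : E3) r <;> simp only [indicator_of_mem, indicator_of_notMem,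
      hx, not_false_eq_true, Pi.one_apply, mul_one, mul_zero]
  have h3 : ∫ x, (Metric.ball (0 : E3) r).indicator (1 : E3 → ℝ) x ^ (n + 1) =
      Real.pi * 4 / 3 * r ^ 3 := by
    have : ∀ x, (Metric.ball (0 : E3) r).indicator (1 : E3 → ℝ) x ^ (n + 1) =
        (Metric.ball (0 : E3) r).indicator (1 : E3 → ℝ) x := by
      intro x
      by_cases hx : x ∈ Metric.ball (0 : E3) r
      · simp only [indicator_of_mem hx, Pi.one_apply, Real.one_rpow]
      · simp only [indicator_of_notMem hx]
        exact Real.zero_rpow (by positivity)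
    simp_rw [this]
    rw [integral_indicator_one hball, measureReal_def, EuclideanSpace.volume_ball_fin_three,
      ENNReal.toReal_mul, ENNReal.toReal_pow, ENNReal.toReal_ofReal hr,
      ENNReal.toReal_ofReal (by positivity)]
    ring
  rw [h2, h3] at h1
  refine h1.trans (le_of_eq ?_)
  rw [Real.mul_rpow (by positivity) (by positivity), ← Real.rpow_natCast, ← Real.rpow_mul hr]
  push_cast
  rw [mul_one_div, mul_assoc]

/-- A common majorant for radial fields. -/
noncomputable def fieldBound (A M b : ℝ) (x : E3) : ℝ :=
  (Metric.ball 0 1).indicator (fun x => A * ‖x‖ ^ (b - 2)) x +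
    (Metric.ball 0 1)ᶜ.indicator (fun x => M * ‖x‖ ^ (-2 : ℝ)) x

theorem measurable_fieldBound (A M b : ℝ) : Measurable (fieldBound A M b) := by
  have hball := measurableSet_ball (x := (0 : E3)) (ε := 1)
  exact (Measurable.indicator (by fun_prop) hball).add
    (Measurable.indicator (by fun_prop) hball.compl)

theorem fieldBound_sq (A M b : ℝ) (x : E3) :
    fieldBound A M b x ^ 2 =
      A ^ 2 * (Metric.ball 0 1).indicator (fun x : E3 => ‖x‖ ^ (2 * b - 4)) x +
      M ^ 2 * (Metric.ball 0 1)ᶜ.indicator (fun x : E3 => ‖x‖ ^ (-4 : ℝ)) x := by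
  have hsq : ∀ s : ℝ, (‖x‖ ^ s) ^ 2 = ‖x‖ ^ (2 * s) := fun s => by
    rw [← Real.rpow_natCast, ← Real.rpow_mul (norm_nonneg _)]
    push_cast
    ring_nf
  by_cases hx : x ∈ Metric.ball (0 : E3) 1
  · have hx' : x ∉ (Metric.ball (0 : E3) 1)ᶜ := fun h => h hx
    simp only [fieldBound, indicator_of_mem hx, indicator_of_notMem hx', add_zero, mul_zero]
    rw [mul_pow, hsq]
    ring_nf
  · have hx' : x ∈ (Metric.ball (0 : E3) 1)ᶜ := hx
    simp only [fieldBound, indicator_of_mem hx', indicator_of_notMem hx, zero_add, mul_zero]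
    rw [mul_pow, hsq]
    ring_nf

theorem integrable_indicator_fieldBound {b : ℝ} (hb : 1 / 2 < b) :
    Integrable ((Metric.ball 0 1).indicator fun x : E3 => ‖x‖ ^ (2 * b - 4)) ∧
    Integrable ((Metric.ball 0 1)ᶜ.indicator fun x : E3 => ‖x‖ ^ (-4 : ℝ)) := by
  have hball := measurableSet_ball (x := (0 : E3)) (ε := 1)
  rw [integrable_indicator_iff hball, integrable_indicator_iff hball.compl]
  exact ⟨integrableOn_rpow_norm_ball (by linarith) 1,
    integrableOn_rpow_norm_compl_ball (by norm_num) one_pos⟩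

/-- The square behaves like `‖x‖ ^ (2 * b - 4)` near the origin, and `2 * b - 4 > -3` is the
condition on `b`; at infinity it decays like `‖x‖ ^ (-4)`. -/
theorem memLp_fieldBound (A M : ℝ) {b : ℝ} (hb : 1 / 2 < b) :
    MemLp (fieldBound A M b) 2 volume := by
  rw [memLp_two_iff_integrable_sq (measurable_fieldBound A M b).aestronglyMeasurable]
  simp_rw [fieldBound_sq]
  obtain ⟨h1, h2⟩ := integrable_indicator_fieldBound hb
  exact (h1.const_mul _).add (h2.const_mul _)

theorem norm_radialField_le_fieldBound {m : ℝ → ℝ} {A M b : ℝ} (hA0 : 0 ≤ A)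
    (h0 : ∀ r, 0 ≤ m r) (hM : ∀ r, m r ≤ M) (hA : ∀ r, 0 ≤ r → m r ≤ A * r ^ b) (x : E3) :
    ‖radialField m x‖ ≤ fieldBound A M b x := by
  rcases eq_or_ne x 0 with rfl | hx0
  · simp only [radialField, smul_zero, norm_zero, fieldBound]
    have hM0 : 0 ≤ M := (h0 0).trans (hM 0)
    exact add_nonneg (indicator_nonneg (fun _ _ => by positivity) _)
      (indicator_nonneg (fun _ _ => by positivity) _)
  have hn := norm_pos_iff.2 hx0
  rw [norm_radialField (h0 _)]
  by_cases hx : x ∈ Metric.ball (0 : E3) 1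
  · have hx' : x ∉ (Metric.ball (0 : E3) 1)ᶜ := fun h => h hx
    simp only [fieldBound, indicator_of_mem hx, indicator_of_notMem hx', add_zero]
    rw [Real.rpow_sub hn, ← mul_div_assoc, Real.rpow_two]
    gcongr
    exact hA _ hn.le
  · have hx' : x ∈ (Metric.ball (0 : E3) 1)ᶜ := hx
    simp only [fieldBound, indicator_of_mem hx', indicator_of_notMem hx, zero_add]
    rw [Real.rpow_neg hn.le, Real.rpow_two, div_eq_mul_inv]
    gcongr
    exact hM _

theorem IsLpDensity.massIn_le {n M : ℝ} {ρ : E3 → ℝ} (h : IsLpDensity n M ρ) (r : ℝ) :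
    massIn ρ r ≤ M :=
  h.mass ▸ _root_.massIn_le h.integrable h.nonneg r

theorem IsLpDensity.measurable_radialField {n M : ℝ} {ρ : E3 → ℝ} (h : IsLpDensity n M ρ) :
    Measurable (radialField (massIn ρ)) :=
  _root_.measurable_radialField (massIn_mono h.integrable h.nonneg).measurable

theorem IsLpDensity.gradNewton_ae_eq {n M : ℝ} {ρ : E3 → ℝ} (h : IsLpDensity n M ρ) :
    gradNewton ρ =ᵐ[volume] radialField (massIn ρ) :=
  _root_.gradNewton_ae_eq h.integrable h.symmetric h.nonneg

theorem half_lt_three_div {n : ℝ} (hn : 0 < n) (hn3 : n < 3) : 1 / 2 < 3 / (n + 1) := by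
  rw [lt_div_iff₀ (by positivity)]
  linarith

theorem IsLpDensity.norm_radialField_le {n M : ℝ} (hn : 0 < n) {ρ : E3 → ℝ}
    (h : IsLpDensity n M ρ) {T : ℝ} (hT : ∫ x, ρ x ^ (1 + 1 / n) ≤ T) (x : E3) :
    ‖radialField (massIn ρ) x‖ ≤
      fieldBound (T ^ (1 / (1 + 1 / n)) * (Real.pi * 4 / 3) ^ (1 / (n + 1))) M (3 / (n + 1)) x := by
  have hI : 0 ≤ ∫ x, ρ x ^ (1 + 1 / n) :=
    integral_nonneg_of_ae (h.nonneg.mono fun x hx => Real.rpow_nonneg hx _)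
  have hT0 : 0 ≤ T := hI.trans hT
  refine norm_radialField_le_fieldBound (by positivity) (massIn_nonneg h.nonneg) h.massIn_le
    (fun r hr => (massIn_le_rpow hn h.nonneg h.memLp hr).trans ?_) x
  gcongr

theorem IsLpDensity.memLp_radialField {n M : ℝ} (hn : 0 < n) (hn3 : n < 3) {ρ : E3 → ℝ}
    (h : IsLpDensity n M ρ) : MemLp (radialField (massIn ρ)) 2 volume :=
  (memLp_fieldBound _ M (half_lt_three_div hn hn3)).mono
    h.measurable_radialField.aestronglyMeasurable
    (Eventually.of_forall fun x => (h.norm_radialField_le hn le_rfl x).trans (Real.le_norm_self _))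

/-- The field energy grows sublinearly in `∫ ρ^(1+1/n)`, as `n < 3`. -/
theorem exists_integral_sq_radialField_le {n M : ℝ} (hn : 0 < n) (hn3 : n < 3) (hM : 0 < M) :
    ∃ C κ : ℝ, 0 < C ∧ 0 < κ ∧ κ < 1 ∧ ∀ ρ, IsLpDensity n M ρ →
      ∫ x, ‖radialField (massIn ρ) x‖ ^ 2 ≤ C * (∫ x, ρ x ^ (1 + 1 / n)) ^ κ + C := by
  -- Write `m = m ^ (1 - θ / 2) * m ^ (θ / 2)`, bounding the first factor by total mass and the
  -- second by Hölder. Square integrability at the origin needs `θ > (n + 1) / 3`, sublinearity in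
  -- `T` needs `θ < p = (n + 1) / n`, and `θ < 2` keeps the first exponent positive. Such a `θ`
  -- exists since `n < 3`.
  obtain ⟨θ, hθ1, hθ2⟩ : ∃ θ, (n + 1) / 3 < θ ∧ θ < min ((n + 1) / n) 2 := by
    refine exists_between (lt_min ?_ (by linarith))
    rw [div_lt_div_iff₀ (by norm_num) hn]
    nlinarith
  have hθn := hθ2.trans_le (min_le_left _ _)
  have hθ2 := hθ2.trans_le (min_le_right _ _)
  have hθ0 : 0 < θ := lt_trans (by positivity) hθ1
  set p := 1 + 1 / n with hp
  have hp0 : 0 < p := by positivity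
  have hpn : (n + 1) / n = p := by rw [hp]; field_simp
  set b := 3 / (n + 1) with hb
  set c := (Real.pi * 4 / 3) ^ (1 / (n + 1)) with hc
  have hc0 : 0 < c := by positivity
  have hb' : 1 / 2 < b * (θ / 2) := by
    rw [div_lt_iff₀ (by norm_num)] at hθ1
    rw [hb, div_mul_div_comm, lt_div_iff₀ (by positivity)]
    linarith
  obtain ⟨h1, h2⟩ := integrable_indicator_fieldBound hb'
  set I₁ := ∫ x, (Metric.ball 0 1).indicator (fun x : E3 => ‖x‖ ^ (2 * (b * (θ / 2)) - 4)) x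
  set I₂ := ∫ x, (Metric.ball 0 1)ᶜ.indicator (fun x : E3 => ‖x‖ ^ (-4 : ℝ)) x
  have hI₁ : 0 ≤ I₁ := integral_nonneg fun x => indicator_nonneg (fun _ _ => by positivity) x
  have hI₂ : 0 ≤ I₂ := integral_nonneg fun x => indicator_nonneg (fun _ _ => by positivity) x
  refine ⟨M ^ (2 - θ) * c ^ θ * I₁ + M ^ 2 * I₂ + 1, θ / p, by positivity, by positivity,
    by rwa [div_lt_one hp0, ← hpn], fun ρ h => ?_⟩
  set T := ∫ x, ρ x ^ p
  have hT : 0 ≤ T := integral_nonneg_of_ae (h.nonneg.mono fun x hx => Real.rpow_nonneg hx _)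
  set A := M ^ (1 - θ / 2) * (T ^ (1 / p) * c) ^ (θ / 2) with hA
  have hA0 : 0 ≤ A := by positivity
  have hbound : ∀ x, ‖radialField (massIn ρ) x‖ ≤ fieldBound A M (b * (θ / 2)) x := by
    refine norm_radialField_le_fieldBound hA0 (massIn_nonneg h.nonneg) h.massIn_le
      fun r hr => ?_
    have hm0 := massIn_nonneg h.nonneg r
    have hm1 := massIn_le_rpow hn h.nonneg h.memLp hr
    calc massIn ρ r = massIn ρ r ^ (1 - θ / 2) * massIn ρ r ^ (θ / 2) := by
          rw [← Real.rpow_add_of_nonneg hm0 (by linarith) (by linarith)]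
          simp
      _ ≤ M ^ (1 - θ / 2) * (T ^ (1 / p) * c * r ^ b) ^ (θ / 2) := by
          gcongr
          · linarith
          · exact h.massIn_le r
      _ = A * r ^ (b * (θ / 2)) := by
          rw [Real.mul_rpow (by positivity) (by positivity), ← Real.rpow_mul hr, hA]
          ring
  have hA2 : A ^ 2 = M ^ (2 - θ) * c ^ θ * T ^ (θ / p) := by
    rw [hA, mul_pow, ← Real.rpow_natCast, ← Real.rpow_natCast, ← Real.rpow_mul hM.le,
      ← Real.rpow_mul (by positivity), Real.mul_rpow (by positivity) hc0.le, ← Real.rpow_mul hT]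
    push_cast
    rw [show (1 - θ / 2) * 2 = 2 - θ by ring, show θ / 2 * 2 = θ by ring,
      show 1 / p * θ = θ / p by ring]
    ring
  calc ∫ x, ‖radialField (massIn ρ) x‖ ^ 2 ≤ ∫ x, fieldBound A M (b * (θ / 2)) x ^ 2 := by
        refine integral_mono_of_nonneg (Eventually.of_forall fun x => by positivity)
          (memLp_fieldBound A M hb').integrable_sq (Eventually.of_forall fun x => ?_)
        exact pow_le_pow_left₀ (norm_nonneg _) (hbound x) 2
    _ = A ^ 2 * I₁ + M ^ 2 * I₂ := by
        simp_rw [fieldBound_sq]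
        rw [integral_add (h1.const_mul _) (h2.const_mul _), integral_const_mul, integral_const_mul]
    _ ≤ _ := by
        rw [hA2]
        have hTκ : 0 ≤ T ^ (θ / p) := by positivity
        have e1 : 0 ≤ M ^ 2 * I₂ * T ^ (θ / p) := by positivity
        have e2 : 0 ≤ M ^ (2 - θ) * c ^ θ * I₁ := by positivity
        nlinarith

/-- `X` is the point where `T ^ κ` meets the line `δ * T`. To its right the power lies below the
line, to its left it is at most `X ^ κ`. -/
theorem exists_rpow_le_linear {κ δ : ℝ} (h0 : 0 < κ) (h1 : κ < 1) (hδ : 0 < δ) :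
    ∃ E : ℝ, 0 < E ∧ ∀ T, 0 ≤ T → T ^ κ ≤ δ * T + E := by
  set X := δ ^ (-(1 / (1 - κ))) with hX
  have hX0 : 0 < X := by positivity
  have hXδ : X ^ (κ - 1) = δ := by
    rw [hX, ← Real.rpow_mul hδ.le]
    have : -(1 / (1 - κ)) * (κ - 1) = 1 := by
      have : 1 - κ ≠ 0 := by linarith
      field_simp
      ring
    rw [this, Real.rpow_one]
  refine ⟨X ^ κ, by positivity, fun T hT => ?_⟩
  rcases le_total X T with h | h
  · have hT0 := hX0.trans_le h
    have : T ^ κ = T ^ (κ - 1) * T := by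
      nth_rw 3 [← Real.rpow_one T]
      rw [← Real.rpow_add hT0]
      simp
    rw [this]
    have h2 : T ^ (κ - 1) ≤ δ := hXδ ▸ Real.rpow_le_rpow_of_nonpos hX0 h (by linarith)
    have : 0 < X ^ κ := by positivity
    nlinarith
  · have := Real.rpow_le_rpow hT h h0.le
    have : 0 ≤ δ * T := by positivity
    linarith

/-! ### Coercivity of the energy -/

section Energy

variable {n M : ℝ} {lam Ψ : ℝ → ℝ} {ρ ρbar σ : E3 → ℝ}

theorem CompactlySupportedAE.exists_massIn_eq (hc : CompactlySupportedAE ρ)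
    (hm : ∫ x, ρ x = M) : ∃ R : ℝ, 0 < R ∧ ∀ r, R ≤ r → massIn ρ r = M := by
  obtain ⟨K, hK, hae⟩ := hc
  obtain ⟨R, hR⟩ := hK.isBounded.subset_ball (0 : E3)
  refine ⟨max R 1, lt_max_of_lt_right one_pos, fun r hr => ?_⟩
  rw [massIn, setIntegral_eq_integral_of_ae_compl_eq_zero, hm]
  filter_upwards [hae] with x hx hxr
  exact hx fun hxK => hxr (Metric.ball_subset_ball ((le_max_left _ _).trans hr) (hR hxK))

theorem IsReferenceDensity.isLpDensity (h : IsReferenceDensity M ρbar) :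
    IsLpDensity n M ρbar where
  integrable := h.continuous.integrable_of_hasCompactSupport h.hasCompactSupport
  symmetric := h.symmetric
  nonneg := Eventually.of_forall h.nonneg
  mass := by
    rw [← h.mass]
    exact integral_congr_ae (Eventually.of_forall fun x => (abs_of_nonneg (h.nonneg x)).symm)
  memLp := h.continuous.memLp_of_hasCompactSupport h.hasCompactSupport

theorem IsReferenceDensity.exists_massIn_eq (h : IsReferenceDensity M ρbar) :
    ∃ R : ℝ, 0 < R ∧ ∀ r, R ≤ r → massIn ρbar r = M :=
  CompactlySupportedAE.exists_massIn_eq ⟨tsupport ρbar, h.hasCompactSupport,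
    Eventually.of_forall fun _ hx => image_eq_zero_of_notMem_tsupport hx⟩
    (h.isLpDensity (n := 1)).mass

section Admissible

theorem memLp_of_casimir (hn : 0 < n) (hΨ : PsiAssumptions n Ψ)
    (hi : Integrable ρ) (h0 : ∀ᵐ x, 0 ≤ ρ x) (hc : Integrable fun x => Ψ (ρ x)) :
    MemLp ρ (ENNReal.ofReal (1 + 1 / n)) := by
  obtain ⟨a, b, ha, hb, hab⟩ := hΨ.exists_rpow_le hn
  have hp : 0 < 1 + 1 / n := by positivity
  rw [← integrable_norm_rpow_iff hi.aestronglyMeasurable (by simpa using hp) ENNReal.ofReal_ne_top,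
    ENNReal.toReal_ofReal hp.le]
  refine ((hi.const_mul a).add (hc.const_mul b)).mono'
    (hi.aestronglyMeasurable.norm.aemeasurable.pow_const _).aestronglyMeasurable ?_
  filter_upwards [h0] with x hx
  rw [Real.norm_of_nonneg (by positivity), Real.norm_of_nonneg hx]
  exact hab _ hx

theorem IsAdmissible.isLpDensity (hn : 0 < n) (hΨ : PsiAssumptions n Ψ)
    (h : IsAdmissible lam Ψ ρbar M ρ) : IsLpDensity n M ρ where
  integrable := h.integrable
  symmetric := h.symmetric
  nonneg := h.nonneg
  mass := by
    rw [← h.mass]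
    exact integral_congr_ae (h.nonneg.mono fun x hx => (abs_of_nonneg hx).symm)
  memLp := memLp_of_casimir hn hΨ h.integrable h.nonneg h.finite_casimir

theorem IsAdmissible.casimir_nonneg (hΨ : PsiAssumptions n Ψ)
    (h : IsAdmissible lam Ψ ρbar M ρ) : 0 ≤ casimir Ψ ρ :=
  integral_nonneg_of_ae (h.nonneg.mono fun _ hx => hΨ.nonneg hx)

theorem exists_integral_rpow_le_casimir (hn : 0 < n) (hΨ : PsiAssumptions n Ψ) :
    ∃ a b : ℝ, 0 < a ∧ 0 < b ∧ ∀ ρ, IsAdmissible lam Ψ ρbar M ρ →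
      ∫ x, ρ x ^ (1 + 1 / n) ≤ a * M + b * casimir Ψ ρ := by
  obtain ⟨a, b, ha, hb, hab⟩ := hΨ.exists_rpow_le hn
  refine ⟨a, b, ha, hb, fun ρ h => ?_⟩
  rw [← (h.isLpDensity hn hΨ).mass, casimir, ← integral_const_mul, ← integral_const_mul,
    ← integral_add (h.integrable.const_mul a) (h.finite_casimir.const_mul b)]
  exact integral_mono_of_nonneg (h.nonneg.mono fun x hx => Real.rpow_nonneg hx _)
    ((h.integrable.const_mul a).add (h.finite_casimir.const_mul b))
    (h.nonneg.mono fun x hx => hab _ hx)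

end Admissible

/-- `Q(|∇U|)` for the radial field of `ρ`. -/
noncomputable def fieldQ (lam : ℝ → ℝ) (ρ : E3 → ℝ) (x : E3) : ℝ :=
  mondQ lam ‖radialField (massIn ρ) x‖

theorem fieldQ_nonneg (hlam : LambdaAssumptions lam) (x : E3) : 0 ≤ fieldQ lam ρ x :=
  mondQ_nonneg hlam (norm_nonneg _)

theorem measurable_fieldQ (hlam : LambdaAssumptions lam) (h : IsLpDensity n M ρ) :
    Measurable (fieldQ lam ρ) := by
  have : fieldQ lam ρ = fun x => mondQ lam |‖radialField (massIn ρ) x‖| := by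
    ext x; rw [abs_norm]; rfl
  rw [this]
  exact (continuous_mondQ_abs hlam).measurable.comp h.measurable_radialField.norm

theorem IsLpDensity.integrableOn_fieldQ (hn : 0 < n) (hn3 : n < 3) (hlam : LambdaAssumptions lam)
    (h : IsLpDensity n M ρ) (R : ℝ) : IntegrableOn (fieldQ lam ρ) (Metric.ball 0 R) := by
  obtain ⟨Λ, hΛ, hle⟩ := mondQ_le hlam
  have hsq := (h.memLp_radialField hn hn3).integrable_norm_pow (by norm_num)
  have h1 : IntegrableOn (fun _ : E3 => (1 : ℝ)) (Metric.ball 0 R) :=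
    integrableOn_const measure_ball_lt_top.ne
  refine ((h1.add hsq.integrableOn).const_mul Λ).mono'
    (measurable_fieldQ hlam h).aestronglyMeasurable (Eventually.of_forall fun x => ?_)
  rw [Real.norm_of_nonneg (fieldQ_nonneg hlam x)]
  exact hle _ (norm_nonneg _)

theorem fieldQ_le_of_massIn_le (hlam : LambdaAssumptions lam) {x : E3}
    (h0 : 0 ≤ massIn ρ ‖x‖) (h : massIn ρ ‖x‖ ≤ massIn σ ‖x‖) :
    fieldQ lam ρ x ≤ fieldQ lam σ x := by
  refine mondQ_mono hlam (norm_nonneg _) ?_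
  rw [norm_radialField h0, norm_radialField (h0.trans h)]
  gcongr

theorem mondIntegrand_ae_eq (hb : IsLpDensity n M ρbar) (h : IsLpDensity n M ρ) :
    mondIntegrand lam ρbar ρ =ᵐ[volume] fun x => fieldQ lam ρ x - fieldQ lam ρbar x := by
  filter_upwards [hb.gradNewton_ae_eq, h.gradNewton_ae_eq] with x h1 h2
  simp only [mondIntegrand, fieldQ, h1, h2]

/-- Splitting the Mondian energy at radius `R`. -/
theorem EpotQ_eq_sub (hb : IsLpDensity n M ρbar) (h : IsLpDensity n M ρ)
    (hi : Integrable (mondIntegrand lam ρbar ρ)) (R : ℝ) :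
    EpotQ lam ρbar ρ = 1 / (4 * Real.pi) *
      ((∫ x in (Metric.ball 0 R)ᶜ, (fieldQ lam ρbar x - fieldQ lam ρ x)) -
        ∫ x in Metric.ball 0 R, (fieldQ lam ρ x - fieldQ lam ρbar x)) := by
  have hae := mondIntegrand_ae_eq (lam := lam) hb h
  rw [EpotQ, integral_congr_ae hae, ← integral_add_compl measurableSet_ball (hi.congr hae)]
  have : ∫ x in (Metric.ball (0 : E3) R)ᶜ, (fieldQ lam ρ x - fieldQ lam ρbar x) =
      -∫ x in (Metric.ball (0 : E3) R)ᶜ, (fieldQ lam ρbar x - fieldQ lam ρ x) := by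
    rw [← integral_neg]
    simp
  rw [this]
  ring

theorem EpotN_eq (h : IsLpDensity n M ρ) :
    EpotN ρ = -(1 / (8 * Real.pi)) * ∫ x, ‖radialField (massIn ρ) x‖ ^ 2 := by
  rw [EpotN]
  congr 1
  refine integral_congr_ae ?_
  filter_upwards [h.gradNewton_ae_eq] with x hx
  rw [hx]

/-- The energy functional controls the Casimir functional. -/
theorem exists_casimir_le_energyHE (hn : 0 < n) (hn3 : n < 3) (hlam : LambdaAssumptions lam)
    (hΨ : PsiAssumptions n Ψ) (hM : 0 < M) (hρbar : IsReferenceDensity M ρbar) :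
    ∃ C : ℝ, ∀ ρ, IsAdmissible lam Ψ ρbar M ρ →
      casimir Ψ ρ ≤ 2 * energyHE lam Ψ ρbar ρ + C := by
  obtain ⟨C, κ, hC, hκ0, hκ1, hK⟩ := exists_integral_sq_radialField_le hn hn3 hM
  obtain ⟨a, b, ha, hb, hT⟩ :=
    exists_integral_rpow_le_casimir (lam := lam) (ρbar := ρbar) (M := M) hn hΨ
  obtain ⟨Λ, hΛ, hQ⟩ := mondQ_le hlam
  obtain ⟨R, hR, hmR⟩ := hρbar.exists_massIn_eq
  have hbar : IsLpDensity n M ρbar := hρbar.isLpDensity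
  set V := volume.real (Metric.ball (0 : E3) R)
  set D := 1 / (8 * Real.pi) + Λ / (4 * Real.pi) with hD
  have hpi := Real.pi_pos
  have hD0 : 0 < D := by positivity
  -- The slope is chosen so that, after `T ≤ a * M + b * casimir`, the term `D * K` absorbs exactly
  -- half of the Casimir functional.
  obtain ⟨E, hE, hlin⟩ := exists_rpow_le_linear hκ0 hκ1 (show 0 < 1 / (2 * b * D * C) by positivity)
  refine ⟨2 * (D * C * E + D * C + a * M / (2 * b) + Λ * V / (4 * Real.pi)), fun ρ h => ?_⟩
  have hρ := h.isLpDensity hn hΨ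
  set K := ∫ x, ‖radialField (massIn ρ) x‖ ^ 2 with hKdef
  set T := ∫ x, ρ x ^ (1 + 1 / n)
  have hT0 : 0 ≤ T := integral_nonneg_of_ae (h.nonneg.mono fun x hx => Real.rpow_nonneg hx _)
  have hsq := (hρ.memLp_radialField hn hn3).integrable_norm_pow (p := 2) (by norm_num)
  -- Beyond `R` the reference density encloses the full mass `M`, so its field dominates that of
  -- `ρ`, and `Q` is monotone. The outer part can therefore be dropped from a lower bound.
  have houter : 0 ≤ ∫ x in (Metric.ball (0 : E3) R)ᶜ, (fieldQ lam ρbar x - fieldQ lam ρ x) := by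
    refine setIntegral_nonneg measurableSet_ball.compl fun x hx => ?_
    have hx' : R ≤ ‖x‖ := by simpa using hx
    refine sub_nonneg.2 (fieldQ_le_of_massIn_le hlam (massIn_nonneg h.nonneg _) ?_)
    rw [hmR _ hx']
    exact hρ.massIn_le _
  have h1 : IntegrableOn (fun _ : E3 => (1 : ℝ)) (Metric.ball 0 R) :=
    integrableOn_const measure_ball_lt_top.ne
  have hinner : ∫ x in Metric.ball (0 : E3) R, (fieldQ lam ρ x - fieldQ lam ρbar x) ≤
      Λ * (V + K) := by
    calc ∫ x in Metric.ball (0 : E3) R, (fieldQ lam ρ x - fieldQ lam ρbar x)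
        ≤ ∫ x in Metric.ball (0 : E3) R, Λ * (1 + ‖radialField (massIn ρ) x‖ ^ 2) := by
          refine integral_mono ((hρ.integrableOn_fieldQ hn hn3 hlam R).sub
            (hbar.integrableOn_fieldQ hn hn3 hlam R))
            ((h1.add hsq.integrableOn).const_mul Λ) fun x => ?_
          have e1 := fieldQ_nonneg (ρ := ρbar) hlam x
          have e2 := hQ _ (norm_nonneg (radialField (massIn ρ) x))
          simp only [fieldQ] at *
          linarith
      _ = Λ * (V + ∫ x in Metric.ball (0 : E3) R, ‖radialField (massIn ρ) x‖ ^ 2) := by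
          rw [integral_const_mul, integral_add h1 hsq.integrableOn]
          simp [V]
      _ ≤ Λ * (V + K) := by
          gcongr
          exact setIntegral_le_integral hsq (Eventually.of_forall fun x => by positivity)
  have hH : casimir Ψ ρ - D * K - Λ * V / (4 * Real.pi) ≤ energyHE lam Ψ ρbar ρ := by
    rw [energyHE, EpotM, EpotN_eq hρ, EpotQ_eq_sub hbar hρ h.finite_EpotQ R, ← hKdef]
    have h2 : -(Λ * (V + K)) ≤
        (∫ x in (Metric.ball (0 : E3) R)ᶜ, (fieldQ lam ρbar x - fieldQ lam ρ x)) -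
        ∫ x in Metric.ball (0 : E3) R, (fieldQ lam ρ x - fieldQ lam ρbar x) := by linarith
    have h3 := mul_le_mul_of_nonneg_left h2 (show 0 ≤ 1 / (4 * Real.pi) by positivity)
    have h4 : D * K + Λ * V / (4 * Real.pi) =
        1 / (8 * Real.pi) * K + 1 / (4 * Real.pi) * (Λ * (V + K)) := by
      rw [hD]; ring
    linarith
  have hDK : D * K ≤ casimir Ψ ρ / 2 + a * M / (2 * b) + D * C * E + D * C := by
    have e1 : D * K ≤ D * (C * (1 / (2 * b * D * C) * T + E) + C) := by
      gcongr
      exact (hK ρ hρ).trans (by gcongr; exact hlin T hT0)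
    have e2 : D * (C * (1 / (2 * b * D * C) * T + E) + C) = T / (2 * b) + D * C * E + D * C := by
      field_simp
    have e3 : T / (2 * b) ≤ casimir Ψ ρ / 2 + a * M / (2 * b) := by
      calc T / (2 * b) ≤ (a * M + b * casimir Ψ ρ) / (2 * b) := by
            gcongr
            exact hT ρ h
        _ = _ := by field_simp; ring
    linarith
  linarith

end Energy

/-! ### Weak limits of densities and convergence of their fields -/

/-- A form of Fatou's lemma. -/
theorem integrable_and_integral_le_of_tendsto {α : Type*} [MeasurableSpace α] {μ : Measure α}
    {F : ℕ → α → ℝ} {f : α → ℝ} {c : ℝ} (hF : ∀ j, Integrable (F j) μ)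
    (hF0 : ∀ j, ∀ᵐ x ∂μ, 0 ≤ F j x) (hlim : ∀ᵐ x ∂μ, Tendsto (fun j => F j x) atTop (𝓝 (f x)))
    (hc : Tendsto (fun j => ∫ x, F j x ∂μ) atTop (𝓝 c)) :
    Integrable f μ ∧ ∫ x, f x ∂μ ≤ c := by
  have hfm : AEStronglyMeasurable f μ :=
    aestronglyMeasurable_of_tendsto_ae atTop (fun j => (hF j).1) hlim
  have hf0 : 0 ≤ᵐ[μ] f := by
    filter_upwards [hlim, ae_all_iff.2 hF0] with x hx h0
    exact ge_of_tendsto' hx h0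
  have hc0 : 0 ≤ c := ge_of_tendsto' hc fun j => integral_nonneg_of_ae (hF0 j)
  have key : ∫⁻ x, ENNReal.ofReal (f x) ∂μ ≤ ENNReal.ofReal c := by
    calc ∫⁻ x, ENNReal.ofReal (f x) ∂μ
        = ∫⁻ x, liminf (fun j => ENNReal.ofReal (F j x)) atTop ∂μ := by
          refine lintegral_congr_ae ?_
          filter_upwards [hlim] with x hx
          exact ((ENNReal.tendsto_ofReal hx).liminf_eq).symm
      _ ≤ liminf (fun j => ∫⁻ x, ENNReal.ofReal (F j x) ∂μ) atTop :=
          lintegral_liminf_le' fun j => (hF j).1.aemeasurable.ennreal_ofReal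
      _ = ENNReal.ofReal c := by
          simp_rw [← ofReal_integral_eq_lintegral_ofReal (hF _) (hF0 _)]
          exact (ENNReal.tendsto_ofReal hc).liminf_eq
  have hfi : Integrable f μ := by
    refine ⟨hfm, ?_⟩
    rw [hasFiniteIntegral_iff_ofReal hf0]
    exact key.trans_lt ENNReal.ofReal_lt_top
  refine ⟨hfi, ?_⟩
  rwa [← ofReal_integral_eq_lintegral_ofReal hfi hf0, ENNReal.ofReal_le_ofReal_iff hc0] at key

/-- `ρ₀` is the limit of `ρ j` when tested against functions in `L^q`. -/
structure IsWeakLimit (q : ℝ≥0∞) (ρ : ℕ → E3 → ℝ) (ρ₀ : E3 → ℝ) : Prop where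
  measurable : Measurable ρ₀
  nonneg : ∀ x, 0 ≤ ρ₀ x
  integrable_mul : ∀ g : E3 → ℝ, MemLp g q volume → Integrable fun x => ρ₀ x * g x
  tendsto : ∀ g : E3 → ℝ, MemLp g q volume →
    Tendsto (fun j => ∫ x, ρ j x * g x) atTop (𝓝 (∫ x, ρ₀ x * g x))

section WeakLimit

variable {q : ℝ≥0∞} {n M : ℝ} {lam Ψ : ℝ → ℝ} {ρ : ℕ → E3 → ℝ} {ρ₀ ρbar : E3 → ℝ}

theorem IsWeakLimit.comp_strictMono (h : IsWeakLimit q ρ ρ₀) {k : ℕ → ℕ} (hk : StrictMono k) :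
    IsWeakLimit q (fun j => ρ (k j)) ρ₀ :=
  ⟨h.measurable, h.nonneg, h.integrable_mul, fun g hg => (h.tendsto g hg).comp hk.tendsto_atTop⟩

theorem integral_mul_indicator_one (f : E3 → ℝ) {S : Set E3} (hS : MeasurableSet S) :
    ∫ x, f x * S.indicator (fun _ => (1 : ℝ)) x = ∫ x in S, f x := by
  rw [← integral_indicator hS]
  congr 1
  ext x
  by_cases hx : x ∈ S <;> simp [hx]

theorem IsWeakLimit.integrableOn (h : IsWeakLimit q ρ ρ₀) {S : Set E3} (hS : MeasurableSet S)
    (hfin : volume S ≠ ⊤) : IntegrableOn ρ₀ S := by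
  rw [← integrable_indicator_iff hS]
  refine (h.integrable_mul _ (memLp_indicator_const q hS (1 : ℝ) (Or.inr hfin))).congr
    (Eventually.of_forall fun x => ?_)
  by_cases hx : x ∈ S <;> simp [hx]

theorem IsWeakLimit.tendsto_setIntegral (h : IsWeakLimit q ρ ρ₀) {S : Set E3}
    (hS : MeasurableSet S) (hfin : volume S ≠ ⊤) :
    Tendsto (fun j => ∫ x in S, ρ j x) atTop (𝓝 (∫ x in S, ρ₀ x)) := by
  have := h.tendsto _ (memLp_indicator_const q hS (1 : ℝ) (Or.inr hfin))
  simpa only [integral_mul_indicator_one _ hS] using this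

theorem IsWeakLimit.tendsto_massIn (h : IsWeakLimit q ρ ρ₀) (r : ℝ) :
    Tendsto (fun j => massIn (ρ j) r) atTop (𝓝 (massIn ρ₀ r)) :=
  h.tendsto_setIntegral measurableSet_ball measure_ball_lt_top.ne

theorem IsWeakLimit.integrable (h : IsWeakLimit q ρ ρ₀) (hρ : ∀ j, IsLpDensity n M (ρ j)) :
    Integrable ρ₀ := by
  have hcov := aecover_ball (μ := (volume : Measure E3)) (x := (0 : E3))
    (tendsto_natCast_atTop_atTop (R := ℝ))
  refine hcov.integrable_of_integral_bounded_of_nonneg_ae M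
    (fun i => h.integrableOn measurableSet_ball measure_ball_lt_top.ne)
    (Eventually.of_forall h.nonneg) (Eventually.of_forall fun i => ?_)
  exact le_of_tendsto' (h.tendsto_massIn i) fun j => (hρ j).massIn_le _

/-- Weak convergence alone gives only an inequality, as mass could escape to infinity; equality
comes from `mass_eq_of_integrableOn_outer`. -/
theorem IsWeakLimit.integral_le (h : IsWeakLimit q ρ ρ₀) (hρ : ∀ j, IsLpDensity n M (ρ j)) :
    ∫ x, ρ₀ x ≤ M :=
  le_of_tendsto' (tendsto_massIn_atTop (h.integrable hρ)) fun r =>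
    le_of_tendsto' (h.tendsto_massIn r) fun j => (hρ j).massIn_le r

/-- Symmetry is tested by integrals over sets `S` of finite measure and their rotations; these pass
to the weak limit. -/
theorem IsWeakLimit.symmetric (h : IsWeakLimit q ρ ρ₀) (hi : Integrable ρ₀)
    (hρ : ∀ j, SphericallySymmetric (ρ j)) : SphericallySymmetric ρ₀ := by
  intro A hA
  have hmp := A.measurePreserving
  have hemb := A.toHomeomorph.measurableEmbedding
  refine Integrable.ae_eq_of_forall_setIntegral_eq (fun x => ρ₀ (A x)) ρ₀
    (hmp.integrable_comp_of_integrable hi) hi fun S hS hfin => ?_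
  have himg : MeasurableSet (A.symm ⁻¹' S) := A.symm.continuous.measurable hS
  have hpre : A ⁻¹' (A.symm ⁻¹' S) = S := by ext x; simp
  have hvol : volume (A.symm ⁻¹' S) = volume S :=
    A.symm.measurePreserving.measure_preimage hS.nullMeasurableSet
  have key : ∀ f : E3 → ℝ, ∫ x in S, f (A x) = ∫ x in A.symm ⁻¹' S, f x := by
    intro f
    have := hmp.setIntegral_preimage_emb hemb f (A.symm ⁻¹' S)
    rwa [hpre] at this
  rw [key]
  refine tendsto_nhds_unique (h.tendsto_setIntegral himg (by rw [hvol]; exact hfin.ne)) ?_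
  refine (h.tendsto_setIntegral hS hfin.ne).congr fun j => ?_
  rw [← key]
  exact setIntegral_congr_ae hS ((hρ j A hA).mono fun x hx _ => hx.symm)

/-- Weak lower semicontinuity of the Casimir functional. -/
theorem IsWeakLimit.casimir_le (h : IsWeakLimit q ρ ρ₀) (hΨ : PsiAssumptions n Ψ)
    (hρ : ∀ j, IsAdmissible lam Ψ ρbar M (ρ j)) (hρq : ∀ j g, MemLp g q volume →
      Integrable fun x => ρ j x * g x) {c : ℝ}
    (hc : Tendsto (fun j => casimir Ψ (ρ j)) atTop (𝓝 c)) :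
    Integrable (fun x => Ψ (ρ₀ x)) ∧ casimir Ψ ρ₀ ≤ c := by
  -- `Ψ' ∘ ρ₀` need not be in `L^q`. Restricted to a ball on which also `ρ₀ ≤ k`, it is bounded with
  -- support of finite measure, hence an admissible test function; the sets exhaust the space.
  let S : ℕ → Set E3 := fun k => Metric.ball 0 k ∩ {x | ρ₀ x ≤ k}
  have hSm : ∀ k, MeasurableSet (S k) := fun k =>
    measurableSet_ball.inter (measurableSet_le h.measurable measurable_const)
  have hSfin : ∀ k, volume (S k) ≠ ⊤ := fun k =>
    ((measure_mono inter_subset_left).trans_lt measure_ball_lt_top).ne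
  have hcov : AECover volume atTop S := by
    refine ⟨Eventually.of_forall fun x => ?_, hSm⟩
    obtain ⟨k₁, hk₁⟩ := exists_nat_gt ‖x‖
    obtain ⟨k₂, hk₂⟩ := exists_nat_ge (ρ₀ x)
    filter_upwards [eventually_ge_atTop (max k₁ k₂)] with k hk
    have e1 : (k₁ : ℝ) ≤ k := by exact_mod_cast (le_max_left _ _).trans hk
    have e2 : (k₂ : ℝ) ≤ k := by exact_mod_cast (le_max_right _ _).trans hk
    exact ⟨by simpa using hk₁.trans_le e1, hk₂.trans e2⟩
  have hmax : ∀ x, max (ρ₀ x) 0 = ρ₀ x := fun x => max_eq_left (h.nonneg x)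
  have hbdd : ∀ u : ℝ → ℝ, Continuous (fun s => u (max s 0)) → ∀ k : ℕ, ∀ q : ℝ≥0∞,
      MemLp ((S k).indicator fun x => u (ρ₀ x)) q volume := by
    intro u hu k q
    obtain ⟨B, hB⟩ := (isCompact_Icc (a := (0 : ℝ)) (b := k)).exists_bound_of_continuousOn
      hu.continuousOn
    have hm : Measurable fun x => u (ρ₀ x) := by
      have := hu.measurable.comp h.measurable
      simpa only [Function.comp_def, hmax] using this
    refine (memLp_indicator_const q (hSm k) B (Or.inr (hSfin k))).mono
      (hm.indicator (hSm k)).aestronglyMeasurable (Eventually.of_forall fun x => ?_)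
    by_cases hx : x ∈ S k
    · simp only [indicator_of_mem hx]
      have := hB (ρ₀ x) ⟨h.nonneg x, hx.2⟩
      simp only [hmax] at this
      exact this.trans (Real.le_norm_self _)
    · simp only [indicator_of_notMem hx, norm_zero, le_refl]
  have hΨi : ∀ k, IntegrableOn (fun x => Ψ (ρ₀ x)) (S k) := fun k => by
    rw [← integrable_indicator_iff (hSm k), ← memLp_one_iff_integrable]
    exact hbdd Ψ hΨ.continuous_comp_max k 1
  have hle : ∀ k, ∫ x in S k, Ψ (ρ₀ x) ≤ c := by
    intro k
    set ψ := (S k).indicator fun x => derivWithin Ψ (Ici 0) (ρ₀ x) with hψ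
    have hψq : MemLp ψ q volume := hbdd _ hΨ.continuous_deriv_comp_max k q
    -- Integrated tangent inequality at `ρ₀`; off `S k` it reduces to `Ψ ≥ 0`. The linear term tends
    -- to zero by weak convergence.
    have h1 : ∀ j, (∫ x in S k, Ψ (ρ₀ x)) + ((∫ x, ρ j x * ψ x) - ∫ x, ρ₀ x * ψ x) ≤
        casimir Ψ (ρ j) := by
      intro j
      have hi1 := (hΨi k).integrable_indicator (hSm k)
      have hi2 : Integrable fun x => ρ j x * ψ x - ρ₀ x * ψ x :=
        (hρq j ψ hψq).sub (h.integrable_mul ψ hψq)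
      rw [← integral_indicator (hSm k), ← integral_sub (hρq j ψ hψq) (h.integrable_mul ψ hψq),
        ← integral_add hi1 hi2]
      refine integral_mono_ae (hi1.add hi2) (hρ j).finite_casimir ?_
      filter_upwards [(hρ j).nonneg] with x hx
      by_cases hxS : x ∈ S k
      · simp only [hψ, indicator_of_mem hxS]
        have := hΨ.tangent_le (h.nonneg x) hx
        linarith
      · simp only [hψ, indicator_of_notMem hxS, mul_zero, sub_zero, add_zero]
        exact hΨ.nonneg hx
    have h2 := ((h.tendsto ψ hψq).sub_const (∫ x, ρ₀ x * ψ x)).const_add (∫ x in S k, Ψ (ρ₀ x))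
    rw [sub_self, add_zero] at h2
    exact le_of_tendsto_of_tendsto' h2 hc h1
  have hint : Integrable fun x => Ψ (ρ₀ x) :=
    hcov.integrable_of_integral_bounded_of_nonneg_ae c hΨi
      (Eventually.of_forall fun x => hΨ.nonneg (h.nonneg x)) (Eventually.of_forall hle)
  exact ⟨hint, le_of_tendsto' (hcov.integral_tendsto_of_countably_generated hint) hle⟩

theorem IsWeakLimit.tendsto_radialField (h : IsWeakLimit q ρ ρ₀) (x : E3) :
    Tendsto (fun j => radialField (massIn (ρ j)) x) atTop (𝓝 (radialField (massIn ρ₀) x)) :=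
  ((h.tendsto_massIn ‖x‖).div_const _).smul_const x

theorem IsWeakLimit.tendsto_fieldQ (h : IsWeakLimit q ρ ρ₀) (hlam : LambdaAssumptions lam)
    (x : E3) : Tendsto (fun j => fieldQ lam (ρ j) x) atTop (𝓝 (fieldQ lam ρ₀ x)) := by
  have := ((continuous_mondQ_abs hlam).tendsto _).comp (h.tendsto_radialField x).norm
  simp only [Function.comp_def, abs_norm] at this
  exact this

end WeakLimit

section FieldLimit

variable {q : ℝ≥0∞} {n M T : ℝ} {lam : ℝ → ℝ} {ρ : ℕ → E3 → ℝ} {ρ₀ ρbar : E3 → ℝ}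

/-- One `L²` majorant serves the whole sequence and the limit, so pointwise convergence of the
fields upgrades to convergence of integrals. -/
theorem IsWeakLimit.exists_fieldBound (h : IsWeakLimit q ρ ρ₀) (hn : 0 < n) (hn3 : n < 3)
    (hρ : ∀ j, IsLpDensity n M (ρ j)) (hT : ∀ j, ∫ x, ρ j x ^ (1 + 1 / n) ≤ T) :
    ∃ B : E3 → ℝ, MemLp B 2 volume ∧ (∀ j x, ‖radialField (massIn (ρ j)) x‖ ≤ B x) ∧
      ∀ x, ‖radialField (massIn ρ₀) x‖ ≤ B x := by
  refine ⟨_, memLp_fieldBound _ M (half_lt_three_div hn hn3),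
    fun j x => (hρ j).norm_radialField_le hn (hT j) x, fun x => ?_⟩
  exact le_of_tendsto' (h.tendsto_radialField x).norm
    fun j => (hρ j).norm_radialField_le hn (hT j) x

theorem IsWeakLimit.tendsto_integral_sq (h : IsWeakLimit q ρ ρ₀)
    (hn : 0 < n) (hn3 : n < 3)
    (hρ : ∀ j, IsLpDensity n M (ρ j)) (hT : ∀ j, ∫ x, ρ j x ^ (1 + 1 / n) ≤ T) :
    Tendsto (fun j => ∫ x, ‖radialField (massIn (ρ j)) x‖ ^ 2) atTop
      (𝓝 (∫ x, ‖radialField (massIn ρ₀) x‖ ^ 2)) := by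
  obtain ⟨B, hB, hle, -⟩ := h.exists_fieldBound hn hn3 hρ hT
  refine tendsto_integral_of_dominated_convergence (fun x => B x ^ 2)
    (fun j => ((hρ j).measurable_radialField.norm.pow_const 2).aestronglyMeasurable)
    hB.integrable_sq (fun j => Eventually.of_forall fun x => ?_)
    (Eventually.of_forall fun x => (h.tendsto_radialField x).norm.pow 2)
  rw [Real.norm_of_nonneg (by positivity)]
  exact pow_le_pow_left₀ (norm_nonneg _) (hle j x) 2

theorem IsWeakLimit.tendsto_inner (h : IsWeakLimit q ρ ρ₀) (hn : 0 < n) (hn3 : n < 3)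
    (hlam : LambdaAssumptions lam) (hbar : IsLpDensity n M ρbar)
    (hρ : ∀ j, IsLpDensity n M (ρ j)) (hT : ∀ j, ∫ x, ρ j x ^ (1 + 1 / n) ≤ T) (R : ℝ) :
    Tendsto (fun j => ∫ x in Metric.ball 0 R, (fieldQ lam (ρ j) x - fieldQ lam ρbar x)) atTop
      (𝓝 (∫ x in Metric.ball 0 R, (fieldQ lam ρ₀ x - fieldQ lam ρbar x))) := by
  obtain ⟨B, hB, hle, -⟩ := h.exists_fieldBound hn hn3 hρ hT
  obtain ⟨Λ, hΛ, hQ⟩ := mondQ_le hlam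
  have h1 : IntegrableOn (fun _ : E3 => (1 : ℝ)) (Metric.ball 0 R) :=
    integrableOn_const measure_ball_lt_top.ne
  refine tendsto_integral_of_dominated_convergence
    (fun x => Λ * (1 + B x ^ 2) + fieldQ lam ρbar x)
    (fun j => ((measurable_fieldQ hlam (hρ j)).sub
      (measurable_fieldQ hlam hbar)).aestronglyMeasurable)
    (((h1.add hB.integrable_sq.integrableOn).const_mul Λ).add
      (hbar.integrableOn_fieldQ hn hn3 hlam R))
    (fun j => Eventually.of_forall fun x => ?_)
    (Eventually.of_forall fun x => (h.tendsto_fieldQ hlam x).sub_const _)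
  refine (norm_sub_le _ _).trans ?_
  rw [Real.norm_of_nonneg (fieldQ_nonneg hlam x), Real.norm_of_nonneg (fieldQ_nonneg hlam x)]
  gcongr
  refine (hQ _ (norm_nonneg _)).trans ?_
  gcongr
  exact hle j x

end FieldLimit

/-! ### The outer region: no loss of mass, and strong convergence -/

section Outer

variable {q : ℝ≥0∞} {n M T : ℝ} {lam Ψ : ℝ → ℝ} {ρ : ℕ → E3 → ℝ} {ρ₀ ρbar σ : E3 → ℝ}

/-- Far out, the mass outside a ball is controlled by the Mondian energy density. -/
theorem exists_le_fieldQ_sub (hlam : LambdaAssumptions lam) (hM : 0 < M)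
    (hρbar : IsReferenceDensity M ρbar) :
    ∃ c R₁ : ℝ, 0 < c ∧ 0 < R₁ ∧ (∀ r, R₁ ≤ r → massIn ρbar r = M) ∧
      ∀ (σ : E3 → ℝ) (x : E3), R₁ ≤ ‖x‖ → 0 ≤ massIn σ ‖x‖ → massIn σ ‖x‖ ≤ M →
        c * ((M - massIn σ ‖x‖) / ‖x‖ ^ 2 * √((M - massIn σ ‖x‖) / ‖x‖ ^ 2)) ≤
          fieldQ lam ρbar x - fieldQ lam σ x := by
  obtain ⟨c, σ₀, hc, hσ₀, hle⟩ := exists_le_mondQ_sub hlam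
  obtain ⟨R, hR, hmR⟩ := hρbar.exists_massIn_eq
  -- Beyond this radius `ρbar` encloses all its mass, and `‖x‖ ≥ 1` with `‖x‖ ≥ M / σ₀` gives `M /
  -- ‖x‖ ^ 2 ≤ σ₀`, the range where the lower bound on `Q` holds.
  refine ⟨c, R + (M / σ₀ + 1), hc, by positivity,
    fun r hr => hmR r ?_, fun σ x hx h0 h1 => ?_⟩
  · have : 0 < M / σ₀ := by positivity
    linarith
  · have hMσ : 0 < M / σ₀ := by positivity
    have hx1 : 1 ≤ ‖x‖ := by linarith
    have hbar := hmR ‖x‖ (by linarith)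
    simp only [fieldQ]
    rw [norm_radialField h0, norm_radialField (by rw [hbar]; exact hM.le), hbar, sub_div]
    refine hle _ _ (by positivity) (by gcongr) ?_
    rw [div_le_iff₀ (by positivity)]
    have : M / σ₀ ≤ ‖x‖ := by linarith
    rw [div_le_iff₀ hσ₀] at this
    nlinarith

/-- Finiteness of the Mondian energy forces the full mass. -/
theorem mass_eq_of_integrableOn_outer (hlam : LambdaAssumptions lam) (hM : 0 < M)
    (hρbar : IsReferenceDensity M ρbar) (hi : Integrable σ) (h0 : ∀ᵐ x, 0 ≤ σ x)
    (hle : ∫ x, σ x ≤ M) {R : ℝ}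
    (hint : IntegrableOn (fun x => fieldQ lam ρbar x - fieldQ lam σ x) (Metric.ball 0 R)ᶜ) :
    ∫ x, σ x = M := by
  by_contra hne
  set δ := M - ∫ x, σ x with hδ
  have hδ0 : 0 < δ := sub_pos.2 (lt_of_le_of_ne hle hne)
  obtain ⟨c, R₁, hc, hR₁, -, hlow⟩ := exists_le_fieldQ_sub hlam hM hρbar
  -- A deficit `δ` makes the outer integrand at least `c * (δ * √δ) / ‖x‖ ^ 3`, so its integrability
  -- would force that of the inverse cube.
  refine not_integrableOn_inv_norm_cube (R := max R R₁) (lt_max_of_lt_right hR₁) ?_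
  have hint' := (hint.mono_set (compl_subset_compl.2
    (Metric.ball_subset_ball (le_max_left R R₁)))).const_mul (c * (δ * √δ))⁻¹
  refine hint'.mono' (Measurable.aestronglyMeasurable (by fun_prop)) ?_
  filter_upwards [ae_restrict_mem measurableSet_ball.compl] with x hx
  have hx' : max R R₁ ≤ ‖x‖ := by simpa using hx
  have hxR := (le_max_right _ _).trans hx'
  have hx0 : 0 < ‖x‖ := hR₁.trans_le hxR
  have hm := massIn_le hi h0 ‖x‖
  have h1 := hlow σ x hxR (massIn_nonneg h0 _) (hm.trans hle)
  rw [Real.norm_of_nonneg (by positivity), inv_mul_eq_div, le_div_iff₀ (by positivity)]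
  refine le_trans ?_ h1
  have h2 : δ / ‖x‖ ^ 2 ≤ (M - massIn σ ‖x‖) / ‖x‖ ^ 2 := by
    gcongr
    linarith
  calc (‖x‖ ^ 3)⁻¹ * (c * (δ * √δ)) = c * (δ / ‖x‖ ^ 2 * √(δ / ‖x‖ ^ 2)) := by
        rw [Real.sqrt_div hδ0.le, Real.sqrt_sq hx0.le]
        field_simp
    _ ≤ _ := by
        have := (show 0 ≤ δ / ‖x‖ ^ 2 by positivity).trans h2
        gcongr

theorem integrableOn_outer (hbar : IsLpDensity n M ρbar) (hσ : IsLpDensity n M σ)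
    (hi : Integrable (mondIntegrand lam ρbar σ)) (S : Set E3) :
    IntegrableOn (fun x => fieldQ lam ρbar x - fieldQ lam σ x) S := by
  refine ((hi.neg.congr ((mondIntegrand_ae_eq hbar hσ).neg)).congr
    (Eventually.of_forall fun x => ?_)).integrableOn
  simp

theorem outer_nonneg (hlam : LambdaAssumptions lam) (hσ : IsLpDensity n M σ) {R : ℝ}
    (hmR : ∀ r, R ≤ r → massIn ρbar r = M) {x : E3} (hx : x ∈ (Metric.ball (0 : E3) R)ᶜ) :
    0 ≤ fieldQ lam ρbar x - fieldQ lam σ x := by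
  have hx' : R ≤ ‖x‖ := by simpa using hx
  refine sub_nonneg.2 (fieldQ_le_of_massIn_le hlam (massIn_nonneg hσ.nonneg _) ?_)
  rw [hmR _ hx']
  exact hσ.massIn_le _

theorem outer_eq (hbar : IsLpDensity n M ρbar) (hσ : IsLpDensity n M σ)
    (hi : Integrable (mondIntegrand lam ρbar σ)) (R : ℝ) :
    ∫ x in (Metric.ball 0 R)ᶜ, (fieldQ lam ρbar x - fieldQ lam σ x) =
      4 * Real.pi * EpotQ lam ρbar σ +
        ∫ x in Metric.ball 0 R, (fieldQ lam σ x - fieldQ lam ρbar x) := by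
  rw [EpotQ_eq_sub hbar hσ hi R]
  have := Real.pi_pos
  field_simp
  ring

/-- The weak limit of a sequence of admissible densities with converging energies. -/
theorem IsWeakLimit.isAdmissible (h : IsWeakLimit q ρ ρ₀) (hn : 0 < n) (hn3 : n < 3)
    (hlam : LambdaAssumptions lam) (hΨ : PsiAssumptions n Ψ) (hM : 0 < M)
    (hρbar : IsReferenceDensity M ρbar) (hρ : ∀ j, IsAdmissible lam Ψ ρbar M (ρ j))
    (hT : ∀ j, ∫ x, ρ j x ^ (1 + 1 / n) ≤ T) (hΨi : Integrable fun x => Ψ (ρ₀ x)) {e : ℝ}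
    (he : Tendsto (fun j => EpotQ lam ρbar (ρ j)) atTop (𝓝 e)) :
    IsAdmissible lam Ψ ρbar M ρ₀ ∧ EpotQ lam ρbar ρ₀ ≤ e := by
  have hbar : IsLpDensity n M ρbar := hρbar.isLpDensity
  have hρL := fun j => (hρ j).isLpDensity hn hΨ
  have hi := h.integrable hρL
  have hsym := h.symmetric hi fun j => (hρ j).symmetric
  have h0 : ∀ᵐ x, 0 ≤ ρ₀ x := Eventually.of_forall h.nonneg
  obtain ⟨R, hR, hmR⟩ := hρbar.exists_massIn_eq
  have hin := h.tendsto_inner hn hn3 hlam hbar hρL hT R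
  -- The outer integrals converge because the Mondian energies and the inner integrals do. Their
  -- integrands are nonnegative, so Fatou applies and makes the outer integral of `ρ₀` finite, which
  -- yields the full mass.
  have hout : Tendsto (fun j => ∫ x in (Metric.ball 0 R)ᶜ,
      (fieldQ lam ρbar x - fieldQ lam (ρ j) x)) atTop
      (𝓝 (4 * Real.pi * e + ∫ x in Metric.ball 0 R, (fieldQ lam ρ₀ x - fieldQ lam ρbar x))) := by
    refine ((he.const_mul (4 * Real.pi)).add hin).congr fun j => ?_
    exact (outer_eq hbar (hρL j) (hρ j).finite_EpotQ R).symm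
  obtain ⟨houti, houtle⟩ := integrable_and_integral_le_of_tendsto
    (fun j => integrableOn_outer hbar (hρL j) (hρ j).finite_EpotQ _)
    (fun j => by
      filter_upwards [ae_restrict_mem measurableSet_ball.compl] with x hx
      exact outer_nonneg hlam (hρL j) hmR hx)
    (Eventually.of_forall fun x => (h.tendsto_fieldQ hlam x).const_sub _) hout
  have hmass := mass_eq_of_integrableOn_outer hlam hM hρbar hi h0 (h.integral_le hρL) houti
  have hL : IsLpDensity n M ρ₀ := ⟨hi, hsym, h0, hmass, memLp_of_casimir hn hΨ hi h0 hΨi⟩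
  have hfin : Integrable (mondIntegrand lam ρbar ρ₀) := by
    have hball := (hL.integrableOn_fieldQ hn hn3 hlam R).sub
      (hbar.integrableOn_fieldQ hn hn3 hlam R)
    have hcompl : IntegrableOn (fun x => fieldQ lam ρ₀ x - fieldQ lam ρbar x)
        (Metric.ball 0 R)ᶜ := by
      refine (Integrable.neg houti).congr (Eventually.of_forall fun x => ?_)
      simp
    have huniv := IntegrableOn.union hball hcompl
    rw [union_compl_self, integrableOn_univ] at huniv
    exact huniv.congr (mondIntegrand_ae_eq hbar hL).symm
  refine ⟨⟨hi, hsym, h0, ?_, hfin, hΨi⟩, ?_⟩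
  · rw [← hmass]
    exact integral_congr_ae (h0.mono fun x hx => abs_of_nonneg hx)
  · rw [outer_eq hbar hL hfin R] at houtle
    have := Real.pi_pos
    nlinarith

theorem IsWeakLimit.convergesStronglyLp_two (h : IsWeakLimit q ρ ρ₀) (hn : 0 < n) (hn3 : n < 3)
    (hρ : ∀ j, IsLpDensity n M (ρ j)) (hρ₀ : IsLpDensity n M ρ₀)
    (hT : ∀ j, ∫ x, ρ j x ^ (1 + 1 / n) ≤ T) :
    ConvergesStronglyLp 2 (fun j => gradNewton (ρ j)) (gradNewton ρ₀) := by
  obtain ⟨B, hB, hle, hle0⟩ := h.exists_fieldBound hn hn3 hρ hT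
  refine ⟨fun j => (memLp_congr_ae (hρ j).gradNewton_ae_eq).2 ((hρ j).memLp_radialField hn hn3),
    (memLp_congr_ae hρ₀.gradNewton_ae_eq).2 (hρ₀.memLp_radialField hn hn3), ?_⟩
  have := tendsto_eLpNorm_sub_of_dominated (μ := volume) two_ne_zero ENNReal.ofNat_ne_top
    (fun j => (hρ j).measurable_radialField.aestronglyMeasurable)
    hρ₀.measurable_radialField.aestronglyMeasurable hB
    (fun j => Eventually.of_forall (hle j)) (Eventually.of_forall hle0)
    (Eventually.of_forall h.tendsto_radialField)
  refine this.congr fun j => eLpNorm_congr_ae ?_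
  filter_upwards [(hρ j).gradNewton_ae_eq, hρ₀.gradNewton_ae_eq] with x h1 h2
  rw [h1, h2]

theorem toReal_three_halves : (3 / 2 : ℝ≥0∞).toReal = 3 / 2 := by simp

theorem norm_radialField_sub {m m₀ : ℝ → ℝ} {x : E3} (h : m ‖x‖ ≤ m₀ ‖x‖) :
    ‖radialField m x - radialField m₀ x‖ = (m₀ ‖x‖ - m ‖x‖) / ‖x‖ ^ 2 := by
  have h1 : radialField m x - radialField m₀ x = -radialField (fun r => m₀ r - m r) x := by
    simp only [radialField, ← sub_smul, ← neg_smul]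
    congr 1
    ring
  rw [h1, norm_neg]
  exact norm_radialField (m := fun r => m₀ r - m r) (sub_nonneg.2 h)

/-- The power `3/2` is written `‖F x‖ * √‖F x‖` to match the lower bound in `exists_le_fieldQ_sub`.
-/
theorem memLp_three_halves_of_bound {α V : Type*} [MeasurableSpace α] {μ : Measure α}
    [NormedAddCommGroup V] {F : α → V} {b : α → ℝ} (hF : AEStronglyMeasurable F μ)
    (hb : Integrable b μ) (h : ∀ᵐ x ∂μ, ‖F x‖ * √‖F x‖ ≤ b x) :
    MemLp F (3 / 2) μ ∧ eLpNorm F (3 / 2) μ ≤ ENNReal.ofReal (∫ x, b x ∂μ) ^ (2 / 3 : ℝ) := by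
  have h32 : (3 / 2 : ℝ≥0∞) ≠ 0 := by simp
  have h32t : (3 / 2 : ℝ≥0∞) ≠ ⊤ := ENNReal.div_ne_top (by simp) (by simp)
  have hb0 : 0 ≤ᵐ[μ] b := h.mono fun x hx => le_trans (by positivity) hx
  have key : eLpNorm F (3 / 2) μ ≤ ENNReal.ofReal (∫ x, b x ∂μ) ^ (2 / 3 : ℝ) := by
    rw [eLpNorm_eq_lintegral_rpow_enorm_toReal h32 h32t, toReal_three_halves,
      show (1 / (3 / 2) : ℝ) = 2 / 3 by norm_num]
    gcongr
    rw [ofReal_integral_eq_lintegral_ofReal hb hb0]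
    refine lintegral_mono_ae (h.mono fun x hx => ?_)
    rw [← ofReal_norm, ENNReal.ofReal_rpow_of_nonneg (norm_nonneg _) (by norm_num)]
    refine ENNReal.ofReal_le_ofReal (le_trans (le_of_eq ?_) hx)
    rw [Real.sqrt_eq_rpow, show (3 / 2 : ℝ) = 1 + 1 / 2 by norm_num,
      Real.rpow_add_of_nonneg (norm_nonneg _) (by norm_num) (by norm_num), Real.rpow_one]
  exact ⟨⟨hF, key.trans_lt (ENNReal.rpow_lt_top_of_nonneg (by norm_num) ENNReal.ofReal_ne_top)⟩,
    key⟩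

/-- On a ball, the `L²` majorant is also an `L^(3/2)` majorant. Outside the support of `ρ₀` the
field difference has norm `(M - m_j) / ‖x‖ ^ 2`, whose `3/2` power is bounded by the nonnegative
outer Mondian integrand of `ρ j`; the integral of that tends to its value at `ρ₀`, which is zero. -/
theorem IsWeakLimit.convergesStronglyLp_three_halves (h : IsWeakLimit q ρ ρ₀) (hn : 0 < n)
    (hn3 : n < 3) (hlam : LambdaAssumptions lam) (hM : 0 < M) (hΨ : PsiAssumptions n Ψ)
    (hρbar : IsReferenceDensity M ρbar) (hρ : ∀ j, IsAdmissible lam Ψ ρbar M (ρ j))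
    (hρ₀ : IsAdmissible lam Ψ ρbar M ρ₀) (hT : ∀ j, ∫ x, ρ j x ^ (1 + 1 / n) ≤ T)
    (he : Tendsto (fun j => EpotQ lam ρbar (ρ j)) atTop (𝓝 (EpotQ lam ρbar ρ₀)))
    (hc : CompactlySupportedAE ρ₀) :
    ConvergesStronglyLp (3 / 2) (fun j x => gradNewton (ρ j) x - gradNewton ρ₀ x)
      (fun _ => (0 : E3)) := by
  have hbar : IsLpDensity n M ρbar := hρbar.isLpDensity
  have hρL := fun j => (hρ j).isLpDensity hn hΨ
  have hL := hρ₀.isLpDensity hn hΨ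
  have h32 : (3 / 2 : ℝ≥0∞) ≠ 0 := by simp
  have h32t : (3 / 2 : ℝ≥0∞) ≠ ⊤ := ENNReal.div_ne_top (by simp) (by simp)
  have h32one : (1 : ℝ≥0∞) ≤ 3 / 2 := by
    rw [ENNReal.le_div_iff_mul_le (by simp) (by simp)]
    norm_num
  have h32two : (3 / 2 : ℝ≥0∞) ≤ 2 := by
    refine ENNReal.div_le_of_le_mul ?_
    norm_num
  obtain ⟨c, R₁, hc0, hR₁, hmbar, hlow⟩ := exists_le_fieldQ_sub hlam hM hρbar
  obtain ⟨R₂, hR₂, hm₀⟩ := hc.exists_massIn_eq hL.mass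
  set R := max R₁ R₂
  set S := Metric.ball (0 : E3) R with hS
  have hSm : MeasurableSet S := measurableSet_ball
  have : IsFiniteMeasure (volume.restrict S) := ⟨by
    rw [Measure.restrict_apply_univ]; exact measure_ball_lt_top⟩
  let d : ℕ → E3 → E3 := fun j x => radialField (massIn (ρ j)) x - radialField (massIn ρ₀) x
  have hdm : ∀ j, Measurable (d j) := fun j =>
    (hρL j).measurable_radialField.sub hL.measurable_radialField
  have hd : ∀ j, (fun x => gradNewton (ρ j) x - gradNewton ρ₀ x) =ᵐ[volume] d j := fun j => by
    filter_upwards [(hρL j).gradNewton_ae_eq, hL.gradNewton_ae_eq] with x h1 h2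
    rw [h1, h2]
  obtain ⟨B, hB, hle, hle0⟩ := h.exists_fieldBound hn hn3 hρL hT
  have hin : Tendsto (fun j => eLpNorm (d j) (3 / 2) (volume.restrict S)) atTop (𝓝 0) :=
    tendsto_eLpNorm_sub_of_dominated h32 h32t
      (fun j => (hρL j).measurable_radialField.aestronglyMeasurable)
      hL.measurable_radialField.aestronglyMeasurable ((hB.restrict S).mono_exponent h32two)
      (fun j => Eventually.of_forall (hle j)) (Eventually.of_forall hle0)
      (Eventually.of_forall h.tendsto_radialField)
  have hinm : ∀ j, MemLp (d j) (3 / 2) (volume.restrict S) := fun j =>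
    ((((hρL j).memLp_radialField hn hn3).sub (hL.memLp_radialField hn hn3)).restrict
      S).mono_exponent h32two
  let b : ℕ → E3 → ℝ := fun j x => c⁻¹ * (fieldQ lam ρbar x - fieldQ lam (ρ j) x)
  have hbi : ∀ j, Integrable (b j) (volume.restrict Sᶜ) := fun j =>
    (integrableOn_outer hbar (hρL j) (hρ j).finite_EpotQ Sᶜ).const_mul _
  have hdb : ∀ j, ∀ᵐ x ∂(volume.restrict Sᶜ), ‖d j x‖ * √‖d j x‖ ≤ b j x := by
    intro j
    filter_upwards [ae_restrict_mem hSm.compl] with x hx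
    have hx' : R ≤ ‖x‖ := by simpa [hS] using hx
    have e1 := hm₀ ‖x‖ ((le_max_right _ _).trans hx')
    have e2 := (hρL j).massIn_le ‖x‖
    simp only [d, b]
    rw [norm_radialField_sub (by rw [e1]; exact e2), e1, inv_mul_eq_div, le_div_iff₀ hc0, mul_comm]
    exact hlow (ρ j) x ((le_max_left _ _).trans hx') (massIn_nonneg (hρ j).nonneg _) e2
  have hout := fun j =>
    memLp_three_halves_of_bound (hdm j).aestronglyMeasurable (hbi j) (hdb j)
  -- Outside `S` both `ρbar` and `ρ₀` enclose mass `M`, so their fields coincide.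
  have hzero : ∫ x in Sᶜ, (fieldQ lam ρbar x - fieldQ lam ρ₀ x) = 0 := by
    rw [setIntegral_congr_fun (g := fun _ => 0) hSm.compl, integral_zero]
    intro x hx
    have hx' : R ≤ ‖x‖ := by simpa [hS] using hx
    have e1 := hm₀ ‖x‖ ((le_max_right _ _).trans hx')
    have e2 := hmbar ‖x‖ ((le_max_left _ _).trans hx')
    simp only [fieldQ, radialField, e1, e2, sub_self]
  have hblim : Tendsto (fun j => ∫ x, b j x ∂(volume.restrict Sᶜ)) atTop (𝓝 0) := by
    have h1 := (he.const_mul (4 * Real.pi)).add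
      (h.tendsto_inner hn hn3 hlam hbar hρL hT R)
    rw [← outer_eq hbar hL hρ₀.finite_EpotQ R, ← hS, hzero] at h1
    have h2 := h1.const_mul c⁻¹
    rw [mul_zero] at h2
    refine h2.congr fun j => ?_
    rw [← outer_eq hbar (hρL j) (hρ j).finite_EpotQ R, integral_const_mul]
  have houtlim : Tendsto (fun j => eLpNorm (d j) (3 / 2) (volume.restrict Sᶜ)) atTop (𝓝 0) := by
    have h1 := (ENNReal.tendsto_ofReal hblim).ennrpow_const (2 / 3 : ℝ)
    rw [ENNReal.ofReal_zero, ENNReal.zero_rpow_of_pos (by norm_num)] at h1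
    exact tendsto_of_tendsto_of_tendsto_of_le_of_le tendsto_const_nhds h1
      (fun _ => zero_le) fun j => (hout j).2
  have hsplit : ∀ j, d j = S.indicator (d j) + Sᶜ.indicator (d j) := fun j =>
    (indicator_self_add_compl S (d j)).symm
  have hmem : ∀ j, MemLp (d j) (3 / 2) volume := fun j => by
    rw [hsplit j]
    exact ((memLp_indicator_iff_restrict hSm).2 (hinm j)).add
      ((memLp_indicator_iff_restrict hSm.compl).2 (hout j).1)
  refine ⟨fun j => (memLp_congr_ae (hd j)).2 (hmem j), MemLp.zero', ?_⟩
  have hsum := hin.add houtlim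
  rw [add_zero] at hsum
  refine tendsto_of_tendsto_of_tendsto_of_le_of_le tendsto_const_nhds hsum
    (fun _ => zero_le) fun j => ?_
  simp only [sub_zero]
  rw [eLpNorm_congr_ae (hd j)]
  nth_rw 1 [hsplit j]
  rw [← eLpNorm_indicator_eq_eLpNorm_restrict hSm,
    ← eLpNorm_indicator_eq_eLpNorm_restrict hSm.compl]
  exact eLpNorm_add_le ((hdm j).indicator hSm).aestronglyMeasurable
    ((hdm j).indicator hSm.compl).aestronglyMeasurable h32one

end Outer

/-! ### Extraction of the subsequence and conclusion -/

/-- Supplies the positive weight used to represent functionals on `L^q`: it is integrable as `4 >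
3`, and being at most `1` it dominates its own powers. -/
theorem memLp_one_add_norm_rpow {s : ℝ} (hs : 1 ≤ s) :
    MemLp (fun x : E3 => (1 + ‖x‖) ^ (-4 : ℝ)) (ENNReal.ofReal s) volume := by
  have hs0 : 0 < s := one_pos.trans_le hs
  have hi : Integrable fun x : E3 => (1 + ‖x‖) ^ (-4 : ℝ) :=
    integrable_one_add_norm (by rw [finrank_E3]; norm_num)
  rw [← integrable_norm_rpow_iff hi.aestronglyMeasurable (by simpa using hs0) ENNReal.ofReal_ne_top,
    ENNReal.toReal_ofReal hs0.le]
  refine hi.mono' (hi.aestronglyMeasurable.norm.aemeasurable.pow_const _).aestronglyMeasurable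
    (Eventually.of_forall fun x => ?_)
  have h0 : 0 ≤ (1 + ‖x‖) ^ (-4 : ℝ) := by positivity
  have h1 : (1 + ‖x‖) ^ (-4 : ℝ) ≤ 1 :=
    Real.rpow_le_one_of_one_le_of_nonpos (by simp) (by norm_num)
  rw [Real.norm_of_nonneg (by positivity), Real.norm_of_nonneg h0]
  exact Real.rpow_le_self_of_le_one h0 h1 hs

theorem norm_toLp_le_of_integral_rpow_le {α : Type*} [MeasurableSpace α] {μ : Measure α} {p T : ℝ}
    (hp : 0 < p) {f : α → ℝ} (hf : MemLp f (ENNReal.ofReal p) μ) (h0 : ∀ᵐ x ∂μ, 0 ≤ f x)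
    (hT : ∫ x, f x ^ p ∂μ ≤ T) : ‖hf.toLp f‖ ≤ T ^ p⁻¹ := by
  rw [Lp.norm_toLp, hf.eLpNorm_eq_integral_rpow_norm (by simpa using hp) ENNReal.ofReal_ne_top,
    ENNReal.toReal_ofReal hp.le]
  have h1 : ∫ x, ‖f x‖ ^ p ∂μ = ∫ x, f x ^ p ∂μ :=
    integral_congr_ae (h0.mono fun x hx => by simp only [Real.norm_of_nonneg hx])
  have h2 : 0 ≤ ∫ x, f x ^ p ∂μ :=
    integral_nonneg_of_ae (h0.mono fun x hx => Real.rpow_nonneg hx _)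
  rw [h1, ENNReal.toReal_ofReal (by positivity)]
  gcongr

/-- Densities with bounded `∫ ρ^(1+1/n)` have weakly convergent subsequences. -/
theorem exists_isWeakLimit {n T : ℝ} (hn : 0 < n) {ρ : ℕ → E3 → ℝ}
    (hp : ∀ j, MemLp (ρ j) (ENNReal.ofReal (1 + 1 / n))) (h0 : ∀ j, ∀ᵐ x, 0 ≤ ρ j x)
    (hT : ∀ j, ∫ x, ρ j x ^ (1 + 1 / n) ≤ T) :
    ∃ k : ℕ → ℕ, StrictMono k ∧ ∃ ρ₀ : E3 → ℝ,
      IsWeakLimit (ENNReal.ofReal (n + 1)) (fun j => ρ (k j)) ρ₀ := by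
  have hpq := holderConjugate_polytropic hn
  have : ENNReal.HolderConjugate (ENNReal.ofReal (1 + 1 / n)) (ENNReal.ofReal (n + 1)) :=
    hpq.ennrealOfReal
  have : Fact (1 ≤ ENNReal.ofReal (1 + 1 / n)) := ⟨by simpa using hpq.lt.le⟩
  have : Fact (1 ≤ ENNReal.ofReal (n + 1)) := ⟨by simpa using hpq.symm.lt.le⟩
  obtain ⟨k, hk, ρ₀, hm, hpos, hlim⟩ := exists_weak_limit_of_nonneg ENNReal.ofReal_ne_top
    (fun x => by positivity) (by fun_prop)
    (memLp_one_add_norm_rpow (show 1 ≤ n + 1 by linarith)) hp h0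
    (fun j => norm_toLp_le_of_integral_rpow_le hpq.pos (hp j) (h0 j) (hT j))
  exact ⟨k, hk, ρ₀, hm, hpos, fun g hg => (hlim g hg).1, fun g hg => (hlim g hg).2⟩

theorem IsWeakLimit.convergesWeaklyLp {n : ℝ} (hn : 0 < n) {ρ : ℕ → E3 → ℝ} {ρ₀ : E3 → ℝ}
    (h : IsWeakLimit (ENNReal.ofReal (n + 1)) ρ ρ₀)
    (hp : ∀ j, MemLp (ρ j) (ENNReal.ofReal (1 + 1 / n)))
    (hp₀ : MemLp ρ₀ (ENNReal.ofReal (1 + 1 / n))) :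
    ConvergesWeaklyLp (ENNReal.ofReal (1 + 1 / n)) ρ ρ₀ := by
  have hpq := holderConjugate_polytropic hn
  have hc : ENNReal.HolderConjugate (ENNReal.ofReal (1 + 1 / n)) (ENNReal.ofReal (n + 1)) :=
    hpq.ennrealOfReal
  refine ⟨hp, hp₀, fun q hq g hg => h.tendsto g ?_⟩
  have h1 := hc.inv_add_inv_eq_one
  rw [← hq] at h1
  have h2 : (ENNReal.ofReal (1 + 1 / n))⁻¹ ≠ ⊤ := by
    rw [ENNReal.inv_ne_top]
    simpa using hpq.pos
  rwa [inv_injective ((ENNReal.add_right_inj h2).1 h1)]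

/-- The infimum of a functional bounded below along a minimizing sequence is a real number. -/
theorem IsMinimizingSequence.exists_tendsto {H : (E3 → ℝ) → ℝ} {R : Set (E3 → ℝ)}
    {ρ : ℕ → E3 → ℝ} (h : IsMinimizingSequence H R ρ) {B : ℝ} (hB : ∀ σ ∈ R, B ≤ H σ) :
    ∃ a : ℝ, Tendsto (fun j => H (ρ j)) atTop (𝓝 a) ∧ ∀ σ ∈ R, a ≤ H σ := by
  obtain ⟨hmem, hlim⟩ := h
  set I : EReal := ⨅ σ ∈ R, (H σ : EReal) with hI
  have hle : ∀ σ ∈ R, I ≤ H σ := fun σ hσ => iInf₂_le σ hσ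
  have hge : (B : EReal) ≤ I := le_iInf₂ fun σ hσ => EReal.coe_le_coe_iff.2 (hB σ hσ)
  have htop : I ≠ ⊤ := ((hle _ (hmem 0)).trans_lt (EReal.coe_lt_top _)).ne
  have hbot : I ≠ ⊥ := ((EReal.bot_lt_coe B).trans_le hge).ne'
  rw [← EReal.coe_toReal htop hbot] at hlim hle
  exact ⟨I.toReal, EReal.tendsto_coe.1 hlim, fun σ hσ => EReal.coe_le_coe_iff.1 (hle σ hσ)⟩

theorem mainTheorem1
    (n : ℝ) (hn0 : 0 < n) (hn3 : n < 3)
    (lam : ℝ → ℝ) (hlam : LambdaAssumptions lam)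
    (Ψ : ℝ → ℝ) (hΨ : PsiAssumptions n Ψ)
    (M : ℝ) (hM : 0 < M)
    (ρbar : E3 → ℝ) (hρbar : IsReferenceDensity M ρbar)
    (ρ : ℕ → E3 → ℝ)
    (hρ : IsMinimizingSequence (energyHE lam Ψ ρbar) (admissibleSet lam Ψ ρbar M) ρ) :
    ∃ k : ℕ → ℕ, StrictMono k ∧ ∃ ρ₀ : E3 → ℝ,
      ConvergesWeaklyLp (ENNReal.ofReal (1 + 1 / n)) (fun j => ρ (k j)) ρ₀ ∧
      ρ₀ ∈ admissibleSet lam Ψ ρbar M ∧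
      IsMinOn (energyHE lam Ψ ρbar) (admissibleSet lam Ψ ρbar M) ρ₀ ∧
      ConvergesStronglyLp 2 (fun j => gradNewton (ρ (k j))) (gradNewton ρ₀) ∧
      (CompactlySupportedAE ρ₀ →
        ConvergesStronglyLp (3 / 2)
          (fun j x => gradNewton (ρ (k j)) x - gradNewton ρ₀ x) (fun _ => (0 : E3))) := by
  obtain ⟨C, hC⟩ := exists_casimir_le_energyHE hn0 hn3 hlam hΨ hM hρbar
  obtain ⟨a, hHlim, hHmin⟩ := hρ.exists_tendsto (B := -C / 2) fun σ hσ => by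
    have h1 := hC σ hσ
    have h2 := IsAdmissible.casimir_nonneg hΨ hσ
    linarith
  have hadm : ∀ j, IsAdmissible lam Ψ ρbar M (ρ j) := hρ.1
  obtain ⟨h, hh⟩ := hHlim.bddAbove_range
  have hcas : ∀ j, casimir Ψ (ρ j) ∈ Icc 0 (2 * h + C) := fun j =>
    ⟨(hadm j).casimir_nonneg hΨ, by linarith [hC _ (hadm j), hh (mem_range_self j)]⟩
  obtain ⟨A, B, -, hB, hAB⟩ :=
    exists_integral_rpow_le_casimir (lam := lam) (ρbar := ρbar) (M := M) hn0 hΨ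
  have hT : ∀ j, ∫ x, ρ j x ^ (1 + 1 / n) ≤ A * M + B * (2 * h + C) := fun j =>
    (hAB _ (hadm j)).trans (by gcongr; exact (hcas j).2)
  have hL := fun j => (hadm j).isLpDensity hn0 hΨ
  obtain ⟨k₁, hk₁, ρ₀, hw₁⟩ := exists_isWeakLimit hn0 (fun j => (hL j).memLp)
    (fun j => (hL j).nonneg) hT
  -- A second extraction makes the Casimir values converge. With total and Newtonian energies
  -- convergent, the Mondian energies then converge as well.
  obtain ⟨c, -, k₂, hk₂, hclim⟩ := tendsto_subseq_of_bounded (Metric.isBounded_Icc 0 (2 * h + C))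
    (fun j => hcas (k₁ j))
  have hk : StrictMono fun j => k₁ (k₂ j) := hk₁.comp hk₂
  have hw : IsWeakLimit (ENNReal.ofReal (n + 1)) (fun j => ρ (k₁ (k₂ j))) ρ₀ :=
    hw₁.comp_strictMono hk₂
  have hpq := holderConjugate_polytropic hn0
  have hHC : ENNReal.HolderConjugate (ENNReal.ofReal (1 + 1 / n)) (ENNReal.ofReal (n + 1)) :=
    hpq.ennrealOfReal
  obtain ⟨hΨi, hcle⟩ := hw.casimir_le hΨ (fun j => hadm _)
    (fun j g hg => (hL _).memLp.integrable_mul hg) hclim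
  have hNlim : Tendsto (fun j => EpotN (ρ (k₁ (k₂ j)))) atTop
      (𝓝 (-(1 / (8 * Real.pi)) * ∫ x, ‖radialField (massIn ρ₀) x‖ ^ 2)) := by
    refine ((hw.tendsto_integral_sq hn0 hn3 (fun j => hL _) (fun j => hT _)).const_mul
      (-(1 / (8 * Real.pi)))).congr fun j => ?_
    exact (EpotN_eq (hL _)).symm
  have hQlim : Tendsto (fun j => EpotQ lam ρbar (ρ (k₁ (k₂ j)))) atTop
      (𝓝 (a - c - -(1 / (8 * Real.pi)) * ∫ x, ‖radialField (massIn ρ₀) x‖ ^ 2)) := by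
    refine (((hHlim.comp hk.tendsto_atTop).sub hclim).sub hNlim).congr fun j => ?_
    simp only [Function.comp_def, energyHE, EpotM]
    ring
  obtain ⟨hadm₀, hQle⟩ := hw.isAdmissible hn0 hn3 hlam hΨ hM hρbar (fun j => hadm _)
    (fun j => hT _) hΨi hQlim
  have hL₀ := hadm₀.isLpDensity hn0 hΨ
  have hH₀ : energyHE lam Ψ ρbar ρ₀ = -(1 / (8 * Real.pi)) *
      (∫ x, ‖radialField (massIn ρ₀) x‖ ^ 2) + EpotQ lam ρbar ρ₀ + casimir Ψ ρ₀ := by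
    rw [energyHE, EpotM, EpotN_eq hL₀]
  have hmin := hHmin ρ₀ hadm₀
  refine ⟨_, hk, ρ₀, hw.convergesWeaklyLp hn0 (fun j => (hL _).memLp) hL₀.memLp, hadm₀,
    fun σ hσ => ?_, hw.convergesStronglyLp_two hn0 hn3 (fun j => hL _) hL₀ (fun j => hT _),
    fun hc => hw.convergesStronglyLp_three_halves hn0 hn3 hlam hM hΨ hρbar (fun j => hadm _)
      hadm₀ (fun j => hT _) ?_ hc⟩
  -- The semicontinuity bounds add up to an energy of at most `a` for `ρ₀`, and `a` bounds the
  -- energy from below on the admissible set.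
  · have := hHmin σ hσ
    rw [mem_ofPred_eq]
    linarith
  -- Since the energy of `ρ₀` is also at least `a`, neither semicontinuity inequality can be strict,
  -- so the Mondian energies converge to that of `ρ₀`.
  · have : EpotQ lam ρbar ρ₀ =
        a - c - -(1 / (8 * Real.pi)) * ∫ x, ‖radialField (massIn ρ₀) x‖ ^ 2 := by linarith
    rw [this]
    exact hQlim
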